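/- **Conventions.** A *gauge function* is a continuous non-decreasing $h:[0,\infty)\to[0,\infty)$ with $\lim_{t\to0}h(t)=0$ and $h(t)>0$ for $t>0$. For $F\subset\mathbb C$, $\mathcal H^h(F)=\lim_{\delta\to0}\inf\sum_j h(2r_j)$, where the infimum is over all countable coverings of $F$ by disks $B(z_j,r_j)$ with $2r_j<\delta$ (this depends only on the values of $h$ near $0$). For $K\ge1$, a homeomorphism $\phi:\mathbb C\to\mathbb C$ is *$K$-quasiconformal* if it preserves orientation, belongs to $W^{1,2}_{\rm loc}(\mathbb C)$, and satisfies $\max_\alpha|\partial_\alpha\phi|\le K\min_\alpha|\partial_\alpha\phi|$ a.e., where $\partial_\alpha$ is the weak derivative in the direction $\alpha$. **Theorem 4.1.** There is an absolute constant $C\ge1$ with the following property. Let $K\ge1$, $0<d<2$ and $t_0>0$, put $d'=\frac{2Kd}{2+(K-1)d}$, and let $h^{(S)}(t)=t^d\varepsilon(t)$ be a gauge function such that one of the following holds. (a) $\varepsilon$ is strictly decreasing on $(0,t_0)$, $\varepsilon(t)\to\infty$ as $t\to0$, and $t^\alpha\varepsilon(t)\to0$ as $t\to0$ for every $\alpha>0$.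 (b) $\varepsilon$ is strictly increasing on $(0,t_0)$, $\varepsilon(t)\to0$ as $t\to0$, and $t^\alpha/\varepsilon(t)\to0$ as $t\to0$ for every $\alpha>0$; moreover $\varepsilon(t)^{1/(2-d)}/t$ is non-increasing on $(0,t_0)$, and there is a constant $c$ with $\varepsilon(t)\le c\,\varepsilon(t^K)$ for all $0<t<t_0$. Then there are a compact set $E\subset\mathbb C$ and a $K$-quasiconformal mapping $\phi:\mathbb C\to\mathbb C$ such that $$C^{-1}\le\mathcal H^{h^{(S)}}(E)\le C\qquad\text{and}\qquad\mathcal H^{\tilde h}(\phi(E))>0,$$ where $\tilde h(t)=t^{d'}\,\varepsilon(t^K)^{\frac{2}{2+(K-1)d}}$ in case (a), and $\tilde h(t)=t^{d'}\,\varepsilon(t)^{\frac{2}{2+(K-1)d}}$ in case (b). -/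

import Mathlib

open Set Filter Topology MeasureTheory
open scoped ENNReal

/-- A gauge function (measure function): a continuous non-decreasing function on `[0, ∞)` which
tends to `0` at `0` and is positive on `(0, ∞)`. Values at negative reals are irrelevant. -/
structure IsGauge (h : ℝ → ℝ) : Prop where
  continuousOn : ContinuousOn h (Ici 0)
  monotoneOn : MonotoneOn h (Ici 0)
  tendsto_zero : Tendsto h (𝓝[>] 0) (𝓝 0)
  pos : ∀ t : ℝ, 0 < t → 0 < h t

/-- `ℋ^h_δ(F)`: the infimum of `∑ h(2 r_j)` over all countable coverings of `F` by disks
`B(z_j, r_j)` of diameter `2 r_j < δ`. Radius `0` gives the empty disk, with cost `h 0` (which is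
`0` for a gauge), so that finite coverings are included. -/
noncomputable def hausdorffPre (h : ℝ → ℝ) (δ : ℝ) (F : Set ℂ) : ℝ≥0∞ :=
  ⨅ (z : ℕ → ℂ) (r : ℕ → ℝ) (_ : ∀ j, 0 ≤ r j ∧ 2 * r j < δ)
    (_ : F ⊆ ⋃ j, Metric.ball (z j) (r j)), ∑' j, ENNReal.ofReal (h (2 * r j))

/-- The generalized Hausdorff measure `ℋ^h(F) = lim_{δ → 0} ℋ^h_δ(F)`. As `ℋ^h_δ(F)` grows when
`δ` decreases, the limit is the supremum over `δ > 0`. -/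
noncomputable def gaugeHausdorff (h : ℝ → ℝ) (F : Set ℂ) : ℝ≥0∞ :=
  ⨆ (δ : ℝ) (_ : 0 < δ), hausdorffPre h δ F

/-- A homeomorphism of the plane preserves orientation: it has local degree `+1`, i.e. the image
of each positively oriented circle winds exactly once, counterclockwise, around the image of its
centre. The winding number is read off from a continuous logarithm `a` along the image curve. -/
def OrientationPreserving (φ : ℂ ≃ₜ ℂ) : Prop :=
  ∀ (z : ℂ) (r : ℝ), 0 < r → ∃ a : ℝ → ℂ, Continuous a ∧
    (∀ θ : ℝ, Complex.exp (a θ) = φ (circleMap z r θ) - φ z) ∧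
    a (2 * Real.pi) = a 0 + 2 * Real.pi * Complex.I

/-- `g` is the weak (distributional) derivative of `f : ℂ → ℂ`, as a field of real-linear maps and
tested against real-valued smooth compactly supported functions. -/
def IsWeakFDeriv (f : ℂ → ℂ) (g : ℂ → ℂ →L[ℝ] ℂ) : Prop :=
  LocallyIntegrable f ∧ LocallyIntegrable g ∧
  ∀ η : ℂ → ℝ, ContDiff ℝ (⊤ : ℕ∞) η → HasCompactSupport η → ∀ v : ℂ,
    ∫ w, η w • g w v = -∫ w, (fderiv ℝ η w v) • f w

/-- `f` lies in `L^2_loc` of the plane. -/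
def MemL2Loc {F : Type*} [NormedAddCommGroup F] (f : ℂ → F) : Prop :=
  ∀ s : Set ℂ, IsCompact s → MemLp f 2 (volume.restrict s)

/-- `φ : ℂ → ℂ` is `K`-quasiconformal: an orientation preserving homeomorphism in `W^{1,2}_loc`
whose directional derivatives satisfy `max_α |∂_α φ| ≤ K min_α |∂_α φ|` almost everywhere. -/
def IsQuasiconformal (K : ℝ) (φ : ℂ ≃ₜ ℂ) : Prop :=
  OrientationPreserving φ ∧ MemL2Loc φ ∧
  ∃ D : ℂ → ℂ →L[ℝ] ℂ, IsWeakFDeriv φ D ∧ MemL2Loc D ∧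
    ∀ᵐ w, ∀ u v : ℂ, ‖u‖ = 1 → ‖v‖ = 1 → ‖D w u‖ ≤ K * ‖D w v‖

/-- Case (a): on `(0, t₀)` the function `ε` is strictly decreasing; it tends to `∞` at `0`, but
more slowly than any negative power. -/
structure DecreasingCase (ε : ℝ → ℝ) (t₀ : ℝ) : Prop where
  strictAntiOn : StrictAntiOn ε (Ioo 0 t₀)
  tendsto_atTop : Tendsto ε (𝓝[>] 0) atTop
  subpolynomial : ∀ α : ℝ, 0 < α → Tendsto (fun t => t ^ α * ε t) (𝓝[>] 0) (𝓝 0)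

/-- Case (b): on `(0, t₀)` the function `ε` is strictly increasing; it tends to `0` at `0`, but
more slowly than any positive power; `ε^{1/(2-d)}(t)/t` is decreasing; and `ε(t) ≲ ε(t^K)`. -/
structure IncreasingCase (K d : ℝ) (ε : ℝ → ℝ) (t₀ : ℝ) : Prop where
  strictMonoOn : StrictMonoOn ε (Ioo 0 t₀)
  tendsto_zero : Tendsto ε (𝓝[>] 0) (𝓝 0)
  subpolynomial : ∀ α : ℝ, 0 < α → Tendsto (fun t => t ^ α / ε t) (𝓝[>] 0) (𝓝 0)
  antitoneOn : AntitoneOn (fun t => ε t ^ (1 / (2 - d)) / t) (Ioo 0 t₀)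
  logType : ∃ c : ℝ, ∀ t ∈ Ioo 0 t₀, ε t ≤ c * ε (t ^ K)

/-- The exponent `d' = 2Kd / (2 + (K-1)d)`. -/
noncomputable def targetDim (K d : ℝ) : ℝ := 2 * K * d / (2 + (K - 1) * d)

/-- The target function in case (a): `t^{d'} ε^{2/(2+(K-1)d)}(t^K)`. -/
noncomputable def targetGaugeA (K d : ℝ) (ε : ℝ → ℝ) (t : ℝ) : ℝ :=
  t ^ targetDim K d * ε (t ^ K) ^ (2 / (2 + (K - 1) * d))

/-- The target function in case (b): `t^{d'} ε^{2/(2+(K-1)d)}(t)`. -/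
noncomputable def targetGaugeB (K d : ℝ) (ε : ℝ → ℝ) (t : ℝ) : ℝ :=
  t ^ targetDim K d * ε t ^ (2 / (2 + (K - 1) * d))

/-! The set is a Cantor-type set of nested disks, and the map is an iterated radial stretching. The
unit disk is packed by finitely many disjoint disks, a new packing in each generation, losing so
little area that the product of all the area fractions stays at least 1/2. A cell is a word of
packing disks; its size `q` is `q₀` times the product of their radii, so the sum of `q²` over a
generation is constant up to a factor 2.

A radius function `S` realizes the cell of size `q` by a disk of radius `S q`, concentric with a
packing disk of its parent. The condition `S (R * q) ≤ R * S q` says exactly that this disk fits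
into the packing disk. `IsGauge.exists_radius` solves `h (S q) = c * q ^ 2`; the fit holds because
`h r / r ^ 2` is non-increasing. Each generation then has total gauge `c * ∑ q²`, comparable to 1
once the number of root disks is chosen well. Covering by the cells bounds the measure above, and
the mass distribution principle `le_hausdorffPre`, with mass `q²` on a cell, bounds it below.

In each annulus between a cell and its packing disk, apply the radial map with exponent `1 / K`,
extended by a homothety inside. All previous stretchings are similarities on the parent cell, so
distortions do not multiply, and every finite composition has distortion at most `K`. The
compositions converge to a homeomorphism with the same distortion a.e., since `S q / q → 0` makes
the limit set null; `isQuasiconformal_of_tendsto` passes the weak derivative to the limit. The image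
is the limit set of the same tree for the radius `t = S ^ (1 / K) * q ^ (1 - 1 / K)`.

The mass distribution principle applies again to the image, and only `q² ≤ C * g t` is needed. The
identity `rpow_targetDim_mul` gives `t ^ d' * ε (S q) ^ β = c ^ β * q²` with `β = 2 / (2 + (K - 1) *
d)`. Monotonicity of `ε` replaces `ε (S q)` by the larger `ε (t ^ K)` in the decreasing case and by
the larger `ε t` in the increasing case. -/

/-! ### Winding numbers and orientation. -/

/-- Uniqueness of lifts through the covering `exp`. -/
theorem Complex.eq_of_exp_comp_eq {f g : ℝ → ℂ} (hf : Continuous f) (hg : Continuous g)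
    (h : ∀ x, Complex.exp (f x) = Complex.exp (g x)) {x₀ : ℝ} (h0 : f x₀ = g x₀) : f = g := by
  have key := Complex.isCoveringMapOn_exp.existsUnique_continuousMap_lifts
    (⟨fun x => Complex.exp (g x), by fun_prop⟩ : C(ℝ, ℂ)) (a₀ := x₀) (e₀ := g x₀) rfl
    (fun a => by simp [Complex.exp_ne_zero])
  have := key.unique (y₁ := ⟨f, hf⟩) (y₂ := ⟨g, hg⟩) ⟨h0, funext h⟩ ⟨rfl, rfl⟩
  exact congrArg (fun F : C(ℝ, ℂ) => (F : ℝ → ℂ)) this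

/-- A homeomorphism of the plane which is the identity near infinity preserves orientation. -/
theorem OrientationPreserving.of_eq_self_outside (φ : ℂ ≃ₜ ℂ) (R : ℝ)
    (hφ : ∀ z, R < ‖z‖ → φ z = z) : OrientationPreserving φ := by
  intro z r hr
  -- The circle is deformed into the unit circle about `z₁`. The offset 2 keeps the closed unit disk
  -- around `z₁` in the region where `φ` is the identity. The radius `r ^ (1 - s)` never vanishes,
  -- so injectivity keeps `F` away from 0 and a global logarithm `L` exists.
  set z₁ : ℂ := ((|R| + 2 : ℝ) : ℂ) with hz₁
  let c : ℝ → ℂ := fun s => (1 - s : ℝ) * z + (s : ℝ) * z₁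
  let ρ : ℝ → ℝ := fun s => Real.exp ((1 - s) * Real.log r)
  have hc : Continuous c := by fun_prop
  have hρ : Continuous ρ := by fun_prop
  let F : C(ℝ × ℝ, ℂ) := ⟨fun x => φ (c x.1 + ρ x.1 * Complex.exp (x.2 * Complex.I)) - φ (c x.1), by
    have := φ.continuous
    fun_prop⟩
  have hF : ∀ a, F a ∈ ({0}ᶜ : Set ℂ) := by
    intro a h
    have h1 := φ.injective (sub_eq_zero.1 h)
    have h2 : (ρ a.1 : ℂ) * Complex.exp (a.2 * Complex.I) = 0 := by simpa using h1
    rcases mul_eq_zero.1 h2 with h3 | h3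
    · exact (Real.exp_pos _).ne' (by exact_mod_cast h3)
    · exact Complex.exp_ne_zero _ h3
  obtain ⟨L, ⟨-, hL⟩, -⟩ := Complex.isCoveringMapOn_exp.existsUnique_continuousMap_lifts F
    (a₀ := (0, 0)) (e₀ := Complex.log (F (0, 0))) (Complex.exp_log (hF _)) hF
  have hL' : ∀ x, Complex.exp (L x) = F x := fun x => congrFun hL x
  have hfar : ∀ w : ℂ, ‖w‖ ≤ 1 → φ (z₁ + w) = z₁ + w := by
    intro w hw
    apply hφ
    have h1 : ‖z₁‖ ≤ ‖z₁ + w‖ + ‖w‖ := by simpa using norm_sub_le (z₁ + w) w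
    have h2 : ‖z₁‖ = |R| + 2 := by
      rw [hz₁, Complex.norm_real, Real.norm_of_nonneg (by positivity)]
    linarith [le_abs_self R]
  have hperiod : ∀ s, F (s, 2 * Real.pi) = F (s, 0) := by
    intro s
    simp [F]
  have hF1 : ∀ θ : ℝ, F (1, θ) = Complex.exp (θ * Complex.I) := by
    intro θ
    have h0 := hfar 0 (by simp)
    have h1 := hfar (Complex.exp (θ * Complex.I)) (by rw [Complex.norm_exp_ofReal_mul_I])
    simp only [add_zero] at h0
    simp [F, c, ρ, h0, h1]
  have hone : (fun θ : ℝ => L (1, θ) - L (1, 0)) = fun θ : ℝ => (θ : ℂ) * Complex.I := by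
    refine Complex.eq_of_exp_comp_eq (by fun_prop) (by fun_prop) (fun θ => ?_) (x₀ := 0) (by simp)
    rw [Complex.exp_sub, hL', hL', hF1, hF1]
    simp
  -- The increment over a full turn has exponential 1, hence is constant in `s`; its value is read
  -- off at `s = 1`.
  have hconst : (fun s : ℝ => L (s, 2 * Real.pi) - L (s, 0)) =
      fun _ : ℝ => 2 * Real.pi * Complex.I := by
    refine Complex.eq_of_exp_comp_eq (by fun_prop) (by fun_prop) (fun s => ?_) (x₀ := 1) ?_
    · rw [Complex.exp_sub, hL', hL', hperiod, div_self (hF (s, 0)), Complex.exp_two_pi_mul_I]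
    · simpa using congrFun hone (2 * Real.pi)
  refine ⟨fun θ => L (0, θ), by fun_prop, fun θ => ?_, ?_⟩
  · rw [hL']
    have h1 : ρ 0 = r := by simp [ρ, Real.exp_log hr]
    simp [F, h1, c, circleMap]
  · have := congrFun hconst 0
    linear_combination this

/-! ### Packings of the unit disk. -/

/-- A finite family of disjoint closed disks `closedBall p.1 p.2` inside the unit disk, of radii
at most `1/2`. -/
structure IsPacking (P : Finset (ℂ × ℝ)) : Prop where
  pos : ∀ p ∈ P, 0 < p.2
  le_half : ∀ p ∈ P, p.2 ≤ 1 / 2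
  subset : ∀ p ∈ P, Metric.closedBall p.1 p.2 ⊆ Metric.closedBall 0 1
  disjoint : (P : Set (ℂ × ℝ)).PairwiseDisjoint fun p => Metric.closedBall p.1 p.2

theorem Complex.volume_real_closedBall (a : ℂ) {r : ℝ} (hr : 0 ≤ r) :
    volume.real (Metric.closedBall a r) = Real.pi * r ^ 2 := by
  rw [Measure.real, Complex.volume_closedBall, ENNReal.toReal_mul, ENNReal.toReal_pow,
    ENNReal.toReal_ofReal hr]
  simp [mul_comm]

theorem IsPacking.sum_sq_le_one {P : Finset (ℂ × ℝ)} (hP : IsPacking P) :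
    ∑ p ∈ P, p.2 ^ 2 ≤ 1 := by
  have h1 : volume.real (⋃ p ∈ P, Metric.closedBall p.1 p.2) =
      ∑ p ∈ P, volume.real (Metric.closedBall p.1 p.2) :=
    measureReal_biUnion_finset hP.disjoint (fun p _ => Metric.isClosed_closedBall.measurableSet)
      fun p _ => measure_closedBall_lt_top.ne
  have h2 : volume.real (⋃ p ∈ P, Metric.closedBall p.1 p.2) ≤
      volume.real (Metric.closedBall (0 : ℂ) 1) :=
    measureReal_mono (iUnion₂_subset hP.subset) measure_closedBall_lt_top.ne
  rw [h1, Finset.sum_congr rfl fun p hp => Complex.volume_real_closedBall p.1 (hP.pos p hp).le,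
    ← Finset.mul_sum, Complex.volume_real_closedBall 0 zero_le_one] at h2
  nlinarith [Real.pi_pos]

/-- The unit disk can be filled with disjoint disks up to an arbitrarily small area. -/
theorem exists_isPacking {η : ℝ} (hη : 0 < η) :
    ∃ P : Finset (ℂ × ℝ), IsPacking P ∧ 1 - η ≤ ∑ p ∈ P, p.2 ^ 2 := by
  classical
  -- A countable disjoint family of disks inside the open unit disk covers almost all of it; a
  -- finite subfamily then has nearly full area.
  obtain ⟨t, r, ht, hts, hr, hcov, hdisj⟩ := Besicovitch.exists_disjoint_closedBall_covering_ae
    (volume : Measure ℂ) (fun x => {ρ | Metric.closedBall x ρ ⊆ Metric.ball 0 1})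
    (Metric.ball 0 1) (fun x hx δ hδ => by
      obtain ⟨e, he, h⟩ := Metric.nhds_basis_closedBall.mem_iff.1 (Metric.isOpen_ball.mem_nhds hx)
      refine ⟨min e (δ / 2), ?_, lt_min he (by linarith), ?_⟩
      · exact (Metric.closedBall_subset_closedBall (min_le_left _ _)).trans h
      · exact (min_le_right _ _).trans_lt (by linarith))
    (fun _ => 1 / 2) (fun _ _ => by norm_num)
  have h1 : volume (Metric.ball (0 : ℂ) 1) ≤ ∑' x : t, volume (Metric.closedBall (x : ℂ) (r x)) :=
    calc volume (Metric.ball (0 : ℂ) 1)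
        ≤ volume (⋃ x ∈ t, Metric.closedBall x (r x)) :=
          measure_mono_ae (by
            rw [ae_le_set]
            exact hcov)
      _ ≤ _ := measure_biUnion_le _ ht _
  by_cases hη1 : 1 ≤ η
  · exact ⟨∅, ⟨by simp, by simp, by simp, by simp⟩, by simp [hη1]⟩
  have h2 : ENNReal.ofReal (Real.pi * (1 - η)) <
      ∑' x : t, volume (Metric.closedBall (x : ℂ) (r x)) := by
    refine lt_of_lt_of_le ?_ h1
    rw [← ofReal_measureReal measure_ball_lt_top.ne,
      ENNReal.ofReal_lt_ofReal_iff_of_nonneg (mul_nonneg Real.pi_pos.le (by linarith)),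
      ← Measure.addHaar_real_closedBall_eq_addHaar_real_ball,
      Complex.volume_real_closedBall 0 zero_le_one]
    nlinarith [Real.pi_pos]
  rw [ENNReal.tsum_eq_iSup_sum, lt_iSup_iff] at h2
  obtain ⟨s, hs⟩ := h2
  have hinj : Function.Injective fun x : t => ((x : ℂ), r x) := fun x y h => by
    simp only [Prod.mk.injEq] at h
    exact Subtype.ext h.1
  refine ⟨s.image fun x : t => ((x : ℂ), r x), ⟨?_, ?_, ?_, ?_⟩, ?_⟩
  · rintro p hp
    obtain ⟨x, -, rfl⟩ := Finset.mem_image.1 hp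
    exact (hr x x.2).2.1
  · rintro p hp
    obtain ⟨x, -, rfl⟩ := Finset.mem_image.1 hp
    exact (hr x x.2).2.2.le
  · rintro p hp
    obtain ⟨x, -, rfl⟩ := Finset.mem_image.1 hp
    exact (hr x x.2).1.trans Metric.ball_subset_closedBall
  · intro p hp p' hp' hne
    obtain ⟨x, -, rfl⟩ := Finset.mem_image.1 (Finset.mem_coe.1 hp)
    obtain ⟨y, -, rfl⟩ := Finset.mem_image.1 (Finset.mem_coe.1 hp')
    refine hdisj x.2 y.2 fun h => hne ?_
    rw [Subtype.ext h]
  · rw [Finset.sum_image hinj.injOn]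
    have h3 : ∑ x ∈ s, volume (Metric.closedBall (x : ℂ) (r x)) =
        ENNReal.ofReal (∑ x ∈ s, Real.pi * r x ^ 2) := by
      rw [ENNReal.ofReal_sum_of_nonneg fun x _ => by positivity]
      refine Finset.sum_congr rfl fun x _ => ?_
      rw [← ofReal_measureReal measure_closedBall_lt_top.ne,
        Complex.volume_real_closedBall _ (hr x x.2).2.1.le]
    rw [h3, ENNReal.ofReal_lt_ofReal_iff_of_nonneg (mul_nonneg Real.pi_pos.le (by linarith)),
      ← Finset.mul_sum] at hs
    exact (lt_of_mul_lt_mul_left hs Real.pi_pos.le).le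

/-! ### The tree of cells and its realization by nested disks. -/

/-- The combinatorial data of an iterated disk packing: finitely many disjoint unit disks, and for
every generation a packing of the unit disk. A cell is a word, whose letters (last one first) are
disks of the successive packings. -/
structure DiskTree where
  q₀ : ℝ
  q₀_pos : 0 < q₀
  base : Finset ℂ
  base_disjoint : (base : Set ℂ).PairwiseDisjoint fun c => Metric.closedBall c 1
  pack : ℕ → Finset (ℂ × ℝ)
  isPacking : ∀ n, IsPacking (pack n)
  half_le_prod : ∀ n, 1 / 2 ≤ ∏ k ∈ Finset.range n, ∑ p ∈ pack k, p.2 ^ 2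

/-- A function which assigns to the size of a cell the radius of the disk realizing it. -/
structure DiskTree.IsRadius (τ : DiskTree) (ρ : ℝ → ℝ) : Prop where
  pos : ∀ q ∈ Ioc 0 τ.q₀, 0 < ρ q
  root : ρ τ.q₀ = τ.q₀
  mul_le : ∀ q ∈ Ioc 0 τ.q₀, ∀ R ∈ Ioc (0 : ℝ) 1, ρ (R * q) ≤ R * ρ q

namespace DiskTree

variable (τ : DiskTree)

/-- The size of a cell: the product of the radii of its letters. -/
def size : List (ℂ × ℝ) → ℝ
  | [] => τ.q₀
  | p :: w => p.2 * size w

/-- The centre of the disk realizing a cell. -/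
noncomputable def center (ρ : ℝ → ℝ) : List (ℂ × ℝ) → ℂ
  | [] => 0
  | p :: w => center ρ w + ρ (τ.size w) * p.1

open Classical in
/-- The cells of the `n`-th generation. -/
noncomputable def gen : ℕ → Finset (List (ℂ × ℝ))
  | 0 => τ.base.image fun c => [(c, 1)]
  | n + 1 => (τ.pack n ×ˢ gen n).image fun x => x.1 :: x.2

/-- The disk realizing a cell. -/
def inner (ρ : ℝ → ℝ) (w : List (ℂ × ℝ)) : Set ℂ :=
  Metric.closedBall (τ.center ρ w) (ρ (τ.size w))

/-- The disk of the packing which surrounds the disk realizing the cell `p :: w`. -/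
def outer (ρ : ℝ → ℝ) (p : ℂ × ℝ) (w : List (ℂ × ℝ)) : Set ℂ :=
  Metric.closedBall (τ.center ρ (p :: w)) (p.2 * ρ (τ.size w))

/-- The union of the disks realizing the cells of the `n`-th generation. -/
def level (ρ : ℝ → ℝ) (n : ℕ) : Set ℂ := ⋃ w ∈ τ.gen n, τ.inner ρ w

/-- The limit set. -/
def limitSet (ρ : ℝ → ℝ) : Set ℂ := ⋂ n, τ.level ρ n

variable {τ} {ρ : ℝ → ℝ}

theorem sum_gen_zero (f : List (ℂ × ℝ) → ℝ) : ∑ w ∈ τ.gen 0, f w = ∑ c ∈ τ.base, f [(c, 1)] := by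
  rw [gen, Finset.sum_image]
  intro c _ c' _ h
  simpa using h

theorem sum_gen_succ (n : ℕ) (f : List (ℂ × ℝ) → ℝ) :
    ∑ w ∈ τ.gen (n + 1), f w = ∑ w ∈ τ.gen n, ∑ p ∈ τ.pack n, f (p :: w) := by
  rw [gen, Finset.sum_image, Finset.sum_product_right]
  rintro ⟨p, w⟩ _ ⟨p', w'⟩ _ h
  simpa using h

theorem mem_gen_zero {w : List (ℂ × ℝ)} : w ∈ τ.gen 0 ↔ ∃ c ∈ τ.base, w = [(c, 1)] := by
  simp [gen, eq_comm]

theorem mem_gen_succ {n : ℕ} {w : List (ℂ × ℝ)} :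
    w ∈ τ.gen (n + 1) ↔ ∃ p ∈ τ.pack n, ∃ v ∈ τ.gen n, w = p :: v := by
  simp only [gen, Finset.mem_image, Finset.mem_product]
  constructor
  · rintro ⟨⟨p, v⟩, ⟨h1, h2⟩, rfl⟩
    exact ⟨p, h1, v, h2, rfl⟩
  · rintro ⟨p, h1, v, h2, rfl⟩
    exact ⟨(p, v), ⟨h1, h2⟩, rfl⟩

theorem size_mem : ∀ {n : ℕ} {w : List (ℂ × ℝ)}, w ∈ τ.gen n →
    τ.size w ∈ Ioc 0 (τ.q₀ * (1 / 2) ^ n)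
  | 0, w, hw => by
    obtain ⟨c, -, rfl⟩ := mem_gen_zero.1 hw
    simp [size, τ.q₀_pos]
  | n + 1, w, hw => by
    obtain ⟨p, hp, v, hv, rfl⟩ := mem_gen_succ.1 hw
    have ih := size_mem hv
    have h1 := (τ.isPacking n).pos p hp
    have h2 := (τ.isPacking n).le_half p hp
    refine ⟨mul_pos h1 ih.1, ?_⟩
    calc p.2 * τ.size v ≤ 1 / 2 * (τ.q₀ * (1 / 2) ^ n) :=
          mul_le_mul h2 ih.2 ih.1.le (by norm_num)
      _ = _ := by ring

theorem size_mem' {n : ℕ} {w : List (ℂ × ℝ)} (hw : w ∈ τ.gen n) : τ.size w ∈ Ioc 0 τ.q₀ := by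
  refine ⟨(size_mem hw).1, (size_mem hw).2.trans ?_⟩
  exact mul_le_of_le_one_right τ.q₀_pos.le (pow_le_one₀ (by norm_num) (by norm_num))

theorem sum_size_sq_le (n : ℕ) : ∑ w ∈ τ.gen n, τ.size w ^ 2 ≤ τ.base.card * τ.q₀ ^ 2 := by
  induction n with
  | zero => simp [sum_gen_zero, size]
  | succ n ih =>
    refine le_trans ?_ ih
    rw [sum_gen_succ]
    refine Finset.sum_le_sum fun w _ => ?_
    simp only [size, mul_pow]
    rw [← Finset.sum_mul]
    exact mul_le_of_le_one_left (sq_nonneg _) (τ.isPacking n).sum_sq_le_one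

theorem sum_size_sq (n : ℕ) : ∑ w ∈ τ.gen n, τ.size w ^ 2 =
    τ.base.card * τ.q₀ ^ 2 * ∏ k ∈ Finset.range n, ∑ p ∈ τ.pack k, p.2 ^ 2 := by
  induction n with
  | zero => simp [sum_gen_zero, size]
  | succ n ih =>
    rw [sum_gen_succ, Finset.prod_range_succ, ← mul_assoc, ← ih, Finset.sum_mul]
    refine Finset.sum_congr rfl fun w _ => ?_
    simp only [size, mul_pow]
    rw [← Finset.sum_mul, mul_comm]

theorem le_sum_size_sq (n : ℕ) :
    τ.base.card * τ.q₀ ^ 2 / 2 ≤ ∑ w ∈ τ.gen n, τ.size w ^ 2 := by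
  rw [sum_size_sq]
  have := τ.half_le_prod n
  nlinarith [mul_le_mul_of_nonneg_left this
    (by positivity : (0 : ℝ) ≤ τ.base.card * τ.q₀ ^ 2)]

namespace IsRadius

/-- Scale down from the root, with `R = q / q₀`. -/
theorem le_self (hρ : τ.IsRadius ρ) {q : ℝ} (hq : q ∈ Ioc 0 τ.q₀) : ρ q ≤ q := by
  have h0 := τ.q₀_pos
  have := hρ.mul_le τ.q₀ ⟨h0, le_rfl⟩ (q / τ.q₀) ⟨div_pos hq.1 h0, (div_le_one h0).2 hq.2⟩
  rwa [hρ.root, div_mul_cancel₀ _ h0.ne'] at this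

theorem radius_pos (hρ : τ.IsRadius ρ) {n : ℕ} {w : List (ℂ × ℝ)} (hw : w ∈ τ.gen n) :
    0 < ρ (τ.size w) :=
  hρ.pos _ (size_mem' hw)

theorem radius_le (hρ : τ.IsRadius ρ) {n : ℕ} {w : List (ℂ × ℝ)} (hw : w ∈ τ.gen n) :
    ρ (τ.size w) ≤ τ.q₀ * (1 / 2) ^ n :=
  (hρ.le_self (size_mem' hw)).trans (size_mem hw).2

/-- Normalizing a cell to the unit disk turns the surrounding disks of its children into the
packing, so inclusion and disjointness are inherited from `IsPacking`. -/
theorem mem_outer_iff (hρ : τ.IsRadius ρ) {n : ℕ} {w : List (ℂ × ℝ)} (hw : w ∈ τ.gen n)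
    (p : ℂ × ℝ) (z : ℂ) :
    z ∈ τ.outer ρ p w ↔
      (z - τ.center ρ w) / ρ (τ.size w) ∈ Metric.closedBall p.1 p.2 := by
  have h0 := hρ.radius_pos hw
  have h1 : (ρ (τ.size w) : ℂ) ≠ 0 := by exact_mod_cast h0.ne'
  rw [outer, center, Metric.mem_closedBall, Metric.mem_closedBall, dist_eq_norm, dist_eq_norm,
    show (z - τ.center ρ w) / ρ (τ.size w) - p.1 =
      (z - (τ.center ρ w + ρ (τ.size w) * p.1)) / ρ (τ.size w) by field_simp; ring,
    norm_div, Complex.norm_real, Real.norm_of_nonneg h0.le, div_le_iff₀ h0]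

theorem outer_subset_inner (hρ : τ.IsRadius ρ) {n : ℕ} {w : List (ℂ × ℝ)}
    (hw : w ∈ τ.gen n) {p : ℂ × ℝ}
    (hp : p ∈ τ.pack n) : τ.outer ρ p w ⊆ τ.inner ρ w := by
  intro z hz
  have h0 := hρ.radius_pos hw
  have h := (τ.isPacking n).subset p hp ((hρ.mem_outer_iff hw p z).1 hz)
  rwa [mem_closedBall_zero_iff, norm_div, Complex.norm_real, Real.norm_of_nonneg h0.le,
    div_le_one h0, ← dist_eq_norm] at h

theorem radius_cons_le (hρ : τ.IsRadius ρ) {n : ℕ} {w : List (ℂ × ℝ)} (hw : w ∈ τ.gen n) {p : ℂ × ℝ}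
    (hp : p ∈ τ.pack n) : ρ (τ.size (p :: w)) ≤ p.2 * ρ (τ.size w) :=
  hρ.mul_le _ (size_mem' hw) _ ⟨(τ.isPacking n).pos p hp,
    ((τ.isPacking n).le_half p hp).trans (by norm_num)⟩

theorem inner_cons_subset (hρ : τ.IsRadius ρ) {n : ℕ} {w : List (ℂ × ℝ)}
    (hw : w ∈ τ.gen n) {p : ℂ × ℝ}
    (hp : p ∈ τ.pack n) : τ.inner ρ (p :: w) ⊆ τ.outer ρ p w :=
  Metric.closedBall_subset_closedBall (hρ.radius_cons_le hw hp)

theorem outer_disjoint (hρ : τ.IsRadius ρ) {n : ℕ} {w : List (ℂ × ℝ)} (hw : w ∈ τ.gen n) :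
    (τ.pack n : Set (ℂ × ℝ)).PairwiseDisjoint fun p => τ.outer ρ p w := by
  intro p hp p' hp' hne
  refine Set.disjoint_left.2 fun z hz hz' => ?_
  exact Set.disjoint_left.1 ((τ.isPacking n).disjoint hp hp' hne)
    ((hρ.mem_outer_iff hw p z).1 hz) ((hρ.mem_outer_iff hw p' z).1 hz')

theorem inner_disjoint (hρ : τ.IsRadius ρ) (n : ℕ) :
    (τ.gen n : Set (List (ℂ × ℝ))).PairwiseDisjoint (τ.inner ρ) := by
  induction n with
  | zero =>
    intro w hw w' hw' hne
    obtain ⟨c, hc, rfl⟩ := mem_gen_zero.1 hw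
    obtain ⟨c', hc', rfl⟩ := mem_gen_zero.1 hw'
    have h0 := τ.q₀_pos
    have h0' : (τ.q₀ : ℂ) ≠ 0 := by exact_mod_cast h0.ne'
    have key : ∀ (b z : ℂ), z ∈ τ.inner ρ [(b, 1)] → z / τ.q₀ ∈ Metric.closedBall b 1 := by
      intro b z hz
      simp only [inner, center, size, one_mul, hρ.root, zero_add, Metric.mem_closedBall,
        dist_eq_norm] at hz ⊢
      rw [show z / τ.q₀ - b = (z - τ.q₀ * b) / τ.q₀ by field_simp, norm_div, Complex.norm_real,
        Real.norm_of_nonneg h0.le, div_le_one h0]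
      exact hz
    refine Set.disjoint_left.2 fun z hz hz' => ?_
    exact Set.disjoint_left.1 (τ.base_disjoint hc hc' fun h => hne (by rw [h])) (key _ _ hz)
      (key _ _ hz')
  | succ n ih =>
    intro w hw w' hw' hne
    obtain ⟨p, hp, v, hv, rfl⟩ := mem_gen_succ.1 hw
    obtain ⟨p', hp', v', hv', rfl⟩ := mem_gen_succ.1 hw'
    by_cases hvv : v = v'
    · subst hvv
      exact (hρ.outer_disjoint hv hp hp' fun h => hne (by rw [h])).mono
        (hρ.inner_cons_subset hv hp) (hρ.inner_cons_subset hv hp')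
    · exact (ih hv hv' hvv).mono
        ((hρ.inner_cons_subset hv hp).trans (hρ.outer_subset_inner hv hp))
        ((hρ.inner_cons_subset hv' hp').trans (hρ.outer_subset_inner hv' hp'))

theorem _root_.DiskTree.isCompact_level (n : ℕ) : IsCompact (τ.level ρ n) :=
  (τ.gen n).isCompact_biUnion fun _ _ => isCompact_closedBall _ _

theorem level_succ_subset (hρ : τ.IsRadius ρ) (n : ℕ) : τ.level ρ (n + 1) ⊆ τ.level ρ n := by
  refine iUnion₂_subset fun w hw => ?_
  obtain ⟨p, hp, v, hv, rfl⟩ := mem_gen_succ.1 hw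
  exact ((hρ.inner_cons_subset hv hp).trans (hρ.outer_subset_inner hv hp)).trans
    (subset_biUnion_of_mem (u := fun w => τ.inner ρ w) hv)

theorem level_antitone (hρ : τ.IsRadius ρ) : Antitone (τ.level ρ) :=
  antitone_nat_of_succ_le hρ.level_succ_subset

theorem _root_.DiskTree.isCompact_limitSet : IsCompact (τ.limitSet ρ) :=
  (isCompact_level 0).of_isClosed_subset (isClosed_iInter fun n => (isCompact_level n).isClosed)
    (iInter_subset _ 0)

end IsRadius
end DiskTree

/-! ### The mass distribution principle and bounds for the gauge measure. -/

/-- A disk of radius `s ≥ r` which meets `ball z r` covers a substantial part of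
`closedBall z (3 * r)`. -/
theorem Complex.le_volume_closedBall_inter {c z : ℂ} {s r : ℝ} (hr : 0 < r) (hrs : r ≤ s)
    (h : (Metric.closedBall c s ∩ Metric.ball z r).Nonempty) :
    Real.pi * r ^ 2 ≤ volume.real (Metric.closedBall c s ∩ Metric.closedBall z (3 * r)) := by
  obtain ⟨y, hyc, hyz⟩ := h
  have hs : 0 < s := hr.trans_le hrs
  rw [Metric.mem_closedBall, dist_eq_norm] at hyc
  rw [Metric.mem_ball] at hyz
  -- Move the common point `y` towards `c` by at most `r`: the disk of radius `r` about the new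
  -- point lies in both sets.
  set x : ℂ := y + ((r / s : ℝ) : ℂ) * (c - y) with hx
  have hxy : dist x y ≤ r := by
    rw [dist_eq_norm, hx, add_sub_cancel_left, norm_mul, Complex.norm_real,
      Real.norm_of_nonneg (by positivity), norm_sub_rev]
    calc r / s * ‖y - c‖ ≤ r / s * s := by gcongr
      _ = r := by field_simp
  have hxc : dist x c ≤ s - r := by
    have : x - c = ((1 - r / s : ℝ) : ℂ) * (y - c) := by
      rw [hx]; push_cast; ring
    have h1 : r / s ≤ 1 := (div_le_one hs).2 hrs
    rw [dist_eq_norm, this, norm_mul, Complex.norm_real, Real.norm_of_nonneg (by linarith)]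
    calc (1 - r / s) * ‖y - c‖ ≤ (1 - r / s) * s :=
          mul_le_mul_of_nonneg_left hyc (by linarith)
      _ = s - r := by field_simp
  rw [← Complex.volume_real_closedBall x hr.le]
  refine measureReal_mono (subset_inter (Metric.closedBall_subset_closedBall' (by linarith))
    (Metric.closedBall_subset_closedBall' ?_))
    (measure_ne_top_of_subset inter_subset_left measure_closedBall_lt_top.ne)
  linarith [dist_triangle x y z]

theorem sum_volume_real_inter_le {ι : Type*} {s : Finset ι} {f : ι → Set ℂ} {A B : Set ℂ}
    (hf : (s : Set ι).PairwiseDisjoint f) (hm : ∀ i ∈ s, MeasurableSet (f i))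
    (hsub : ∀ i ∈ s, f i ⊆ A) (hB : MeasurableSet B) (hBtop : volume B ≠ ∞) :
    ∑ i ∈ s, volume.real (f i ∩ B) ≤ volume.real (A ∩ B) := by
  rw [← measureReal_biUnion_finset (fun i hi j hj hij =>
      (hf hi hj hij).mono inter_subset_left inter_subset_left) (fun i hi => (hm i hi).inter hB)
      (fun i _ => measure_ne_top_of_subset inter_subset_right hBtop)]
  exact measureReal_mono (iUnion₂_subset fun i hi => inter_subset_inter_left _ (hsub i hi))
    (measure_ne_top_of_subset inter_subset_right hBtop)

namespace DiskTree

variable {τ : DiskTree} {ρ : ℝ → ℝ}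

open Classical in
/-- The total mass (squared size) of the descendants in generation `k + j` of a cell of
generation `k`, counting only those whose disk meets `U`. -/
noncomputable def massIn (τ : DiskTree) (ρ : ℝ → ℝ) (U : Set ℂ) : ℕ → ℕ → List (ℂ × ℝ) → ℝ
  | 0, _, w => if (τ.inner ρ w ∩ U).Nonempty then τ.size w ^ 2 else 0
  | j + 1, k, w => ∑ p ∈ τ.pack k, massIn τ ρ U j (k + 1) (p :: w)

theorem sum_massIn (U : Set ℂ) (j k : ℕ) :
    ∑ w ∈ τ.gen (k + j), τ.massIn ρ U 0 (k + j) w = ∑ w ∈ τ.gen k, τ.massIn ρ U j k w := by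
  induction j generalizing k with
  | zero => rfl
  | succ j ih =>
    rw [show k + (j + 1) = k + 1 + j by ring, ih, sum_gen_succ]
    rfl

theorem massIn_le (U : Set ℂ) (j k : ℕ) (w : List (ℂ × ℝ)) :
    τ.massIn ρ U j k w ≤ τ.size w ^ 2 := by
  induction j generalizing k w with
  | zero =>
    rw [massIn]
    split_ifs
    · exact le_rfl
    · positivity
  | succ j ih =>
    rw [massIn]
    calc ∑ p ∈ τ.pack k, τ.massIn ρ U j (k + 1) (p :: w)
        ≤ ∑ p ∈ τ.pack k, p.2 ^ 2 * τ.size w ^ 2 :=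
          Finset.sum_le_sum fun p _ => (ih (k + 1) (p :: w)).trans_eq (mul_pow _ _ _)
      _ ≤ _ := by
          rw [← Finset.sum_mul]
          exact mul_le_of_le_one_left (sq_nonneg _) (τ.isPacking k).sum_sq_le_one

namespace IsRadius

theorem massIn_eq_zero (hρ : τ.IsRadius ρ) {U : Set ℂ} (j : ℕ) {k : ℕ} {w : List (ℂ × ℝ)}
    (hw : w ∈ τ.gen k) (h : ¬(τ.inner ρ w ∩ U).Nonempty) : τ.massIn ρ U j k w = 0 := by
  induction j generalizing k w with
  | zero => rw [massIn, if_neg h]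
  | succ j ih =>
    rw [massIn]
    refine Finset.sum_eq_zero fun p hp => ih (mem_gen_succ.2 ⟨p, hp, w, hw, rfl⟩) fun h' => h ?_
    exact h'.mono (inter_subset_inter_left _
      ((hρ.inner_cons_subset hw hp).trans (hρ.outer_subset_inner hw hp)))

/-- Mass is charged to area in `closedBall z (3 * r)` with density `G / (π r²)`. A child larger than
`r` is handled by recursion. For a child of radius at most `r` that meets the ball, there are two
cases. If its packing disk has radius at least `r`, that disk has area at least `π r²` there, which
pays for a mass of at most `G`. Otherwise the packing disk lies entirely in `closedBall z (3 * r)`,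
and its mass-to-area ratio is that of the parent, bounded by `hbig`. The packing disks of one parent
are disjoint, so the charges add up. -/
theorem massIn_le_volume (hρ : τ.IsRadius ρ) {z : ℂ} {r G : ℝ} (hr : 0 < r) (hG : 0 ≤ G)
    (hsmall : ∀ q ∈ Ioc 0 τ.q₀, ρ q ≤ r → q ^ 2 ≤ G)
    (hbig : ∀ q ∈ Ioc 0 τ.q₀, r < ρ q → q ^ 2 * r ^ 2 ≤ G * ρ q ^ 2)
    (j : ℕ) {k : ℕ} (hn : ∀ w ∈ τ.gen (k + j), ρ (τ.size w) ≤ r)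
    {w : List (ℂ × ℝ)} (hw : w ∈ τ.gen k) (hwr : r < ρ (τ.size w)) :
    τ.massIn ρ (Metric.ball z r) j k w ≤ G / (Real.pi * r ^ 2) *
      volume.real (τ.inner ρ w ∩ Metric.closedBall z (3 * r)) := by
  induction j generalizing k w with
  | zero => exact absurd (hn w hw) (not_le.2 hwr)
  | succ j ih =>
    have hκ : 0 ≤ G / (Real.pi * r ^ 2) := by positivity
    have hpr : Real.pi * r ^ 2 ≠ 0 := by positivity
    rw [massIn]
    calc ∑ p ∈ τ.pack k, τ.massIn ρ (Metric.ball z r) j (k + 1) (p :: w)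
        ≤ ∑ p ∈ τ.pack k, G / (Real.pi * r ^ 2) *
            volume.real (τ.outer ρ p w ∩ Metric.closedBall z (3 * r)) := by
          refine Finset.sum_le_sum fun p hp => ?_
          have hpw : p :: w ∈ τ.gen (k + 1) := mem_gen_succ.2 ⟨p, hp, w, hw, rfl⟩
          have hsub := hρ.inner_cons_subset hw hp
          have hfin : volume (τ.outer ρ p w ∩ Metric.closedBall z (3 * r)) ≠ ∞ :=
            measure_ne_top_of_subset inter_subset_right measure_closedBall_lt_top.ne
          by_cases hbigp : r < ρ (τ.size (p :: w))
          · refine (ih (by rwa [show k + 1 + j = k + (j + 1) by ring]) hpw hbigp).trans ?_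
            exact mul_le_mul_of_nonneg_left
              (measureReal_mono (inter_subset_inter_left _ hsub) hfin) hκ
          push Not at hbigp
          by_cases hmeet : (τ.inner ρ (p :: w) ∩ Metric.ball z r).Nonempty
          swap
          · rw [hρ.massIn_eq_zero j hpw hmeet]
            positivity
          have hmeet' := hmeet.mono (inter_subset_inter_left _ hsub)
          have hp0 := (τ.isPacking k).pos p hp
          have hw0 := hρ.radius_pos hw
          refine (massIn_le _ _ _ _).trans ?_
          rcases le_or_gt r (p.2 * ρ (τ.size w)) with h | h
          · calc τ.size (p :: w) ^ 2 ≤ G := hsmall _ (size_mem' hpw) hbigp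
              _ = G / (Real.pi * r ^ 2) * (Real.pi * r ^ 2) := by field_simp
              _ ≤ _ := mul_le_mul_of_nonneg_left
                (Complex.le_volume_closedBall_inter hr h hmeet') hκ
          · have hin : τ.outer ρ p w ⊆ Metric.closedBall z (3 * r) := by
              obtain ⟨y, hy, hyz⟩ := hmeet'
              refine Metric.closedBall_subset_closedBall' ?_
              have h1 := Metric.mem_closedBall'.1 hy
              have h2 := Metric.mem_ball.1 hyz
              linarith [dist_triangle (τ.center ρ (p :: w)) y z]
            have hb := hbig _ (size_mem' hw) hwr
            rw [inter_eq_left.2 hin, outer, Complex.volume_real_closedBall _ (by positivity),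
              div_mul_eq_mul_div, le_div_iff₀ (by positivity)]
            calc τ.size (p :: w) ^ 2 * (Real.pi * r ^ 2)
                = Real.pi * p.2 ^ 2 * (τ.size w ^ 2 * r ^ 2) := by
                  rw [size]; ring
              _ ≤ Real.pi * p.2 ^ 2 * (G * ρ (τ.size w) ^ 2) :=
                  mul_le_mul_of_nonneg_left hb (by positivity)
              _ = _ := by ring
      _ ≤ _ := by
          rw [← Finset.mul_sum]
          exact mul_le_mul_of_nonneg_left (sum_volume_real_inter_le (hρ.outer_disjoint hw)
            (fun _ _ => Metric.isClosed_closedBall.measurableSet)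
            (fun p hp => hρ.outer_subset_inner hw hp) Metric.isClosed_closedBall.measurableSet
            measure_closedBall_lt_top.ne) hκ

/-- As `r < q₀`, every root cell is larger than `r`, so the density estimate starts at the roots; 9
is the ratio of the areas of disks of radii `3 * r` and `r`. -/
theorem sum_massIn_le (hρ : τ.IsRadius ρ) {z : ℂ} {r G : ℝ} (hr : 0 < r) (hr0 : r < τ.q₀)
    (hG : 0 ≤ G) (hsmall : ∀ q ∈ Ioc 0 τ.q₀, ρ q ≤ r → q ^ 2 ≤ G)
    (hbig : ∀ q ∈ Ioc 0 τ.q₀, r < ρ q → q ^ 2 * r ^ 2 ≤ G * ρ q ^ 2)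
    {n : ℕ} (hn : ∀ w ∈ τ.gen n, ρ (τ.size w) ≤ r) :
    ∑ w ∈ τ.gen n, τ.massIn ρ (Metric.ball z r) 0 n w ≤ 9 * G := by
  have hκ : 0 ≤ G / (Real.pi * r ^ 2) := by positivity
  have h0 := sum_massIn (τ := τ) (ρ := ρ) (Metric.ball z r) n 0
  rw [zero_add] at h0
  rw [h0]
  calc ∑ w ∈ τ.gen 0, τ.massIn ρ (Metric.ball z r) n 0 w
      ≤ ∑ w ∈ τ.gen 0, G / (Real.pi * r ^ 2) *
          volume.real (τ.inner ρ w ∩ Metric.closedBall z (3 * r)) := by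
        refine Finset.sum_le_sum fun w hw =>
          hρ.massIn_le_volume hr hG hsmall hbig n (by simpa using hn) hw ?_
        obtain ⟨c, -, rfl⟩ := mem_gen_zero.1 hw
        simpa [size, hρ.root] using hr0
    _ ≤ G / (Real.pi * r ^ 2) * volume.real (univ ∩ Metric.closedBall z (3 * r)) := by
        rw [← Finset.mul_sum]
        exact mul_le_mul_of_nonneg_left (sum_volume_real_inter_le (hρ.inner_disjoint 0)
          (fun _ _ => Metric.isClosed_closedBall.measurableSet) (fun _ _ => subset_univ _)
          Metric.isClosed_closedBall.measurableSet measure_closedBall_lt_top.ne) hκ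
    _ = 9 * G := by
        rw [univ_inter, Complex.volume_real_closedBall _ (by positivity)]
        field_simp
        ring

/-- The mass distribution principle on the limit set. -/
theorem le_hausdorffPre (hρ : τ.IsRadius ρ) {g : ℝ → ℝ} {C δ : ℝ} (hC : 0 < C)
    (hδ : δ ≤ τ.q₀) (hg : ∀ r, 0 < r → 2 * r < δ → 0 ≤ g (2 * r))
    (hsmall : ∀ r, 0 < r → 2 * r < δ → ∀ q ∈ Ioc 0 τ.q₀, ρ q ≤ r → q ^ 2 ≤ C * g (2 * r))
    (hbig : ∀ r, 0 < r → 2 * r < δ → ∀ q ∈ Ioc 0 τ.q₀, r < ρ q →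
      q ^ 2 * r ^ 2 ≤ C * g (2 * r) * ρ q ^ 2) :
    ENNReal.ofReal (τ.base.card * τ.q₀ ^ 2 / (18 * C)) ≤ hausdorffPre g δ (τ.limitSet ρ) := by
  classical
  refine le_iInf₂ fun z r => le_iInf₂ fun hr hcov => ?_
  obtain ⟨J, hJ⟩ := (isCompact_limitSet (τ := τ) (ρ := ρ)).elim_finite_subcover
    (fun j => Metric.ball (z j) (r j)) (fun _ => Metric.isOpen_ball) hcov
  set J' := J.filter fun j => 0 < r j with hJ'
  have hJJ : (⋃ j ∈ J, Metric.ball (z j) (r j)) ⊆ ⋃ j ∈ J', Metric.ball (z j) (r j) := by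
    refine iUnion₂_subset fun j hj x hx => ?_
    have : 0 < r j := Metric.pos_of_mem_ball hx
    exact mem_biUnion (Finset.mem_filter.2 ⟨hj, this⟩) hx
  -- By compactness, a finite cover of the limit set already covers some level, where mass can be
  -- counted cell by cell.
  obtain ⟨n₁, hn₁⟩ := exists_subset_nhds_of_isCompact (V := fun n => τ.level ρ n)
    hρ.level_antitone.directed_ge (fun n => isCompact_level n)
    (U := ⋃ j ∈ J', Metric.ball (z j) (r j)) (fun x hx =>
      (isOpen_biUnion fun _ _ => Metric.isOpen_ball).mem_nhds (hJJ (hJ hx)))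
  obtain ⟨n₂, hn₂⟩ : ∃ n₂ : ℕ, ∀ n ≥ n₂, ∀ j ∈ J', τ.q₀ * (1 / 2) ^ n ≤ r j := by
    have ht : Tendsto (fun n : ℕ => τ.q₀ * (1 / 2 : ℝ) ^ n) atTop (𝓝 0) := by
      simpa using (tendsto_pow_atTop_nhds_zero_of_lt_one (r := (1 / 2 : ℝ)) (by norm_num)
        (by norm_num)).const_mul τ.q₀
    have := (Finset.eventually_all J').2 fun j hj =>
      ht.eventually (ge_mem_nhds (Finset.mem_filter.1 hj).2)
    exact eventually_atTop.1 this
  set n := max n₁ n₂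
  have hn : ∀ j ∈ J', ∀ w ∈ τ.gen n, ρ (τ.size w) ≤ r j := fun j hj w hw =>
    (hρ.radius_le hw).trans (hn₂ n (le_max_right _ _) j hj)
  have hcov' : τ.level ρ n ⊆ ⋃ j ∈ J', Metric.ball (z j) (r j) :=
    (hρ.level_antitone (le_max_left _ _)).trans hn₁
  have hJpos : ∀ j ∈ J', 0 < r j := fun j hj => (Finset.mem_filter.1 hj).2
  -- The final constant 18 combines this 9 with the factor 1/2 of area left by the packings.
  have key : τ.base.card * τ.q₀ ^ 2 / 2 ≤ ∑ j ∈ J', 9 * (C * g (2 * r j)) := by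
    calc (τ.base.card : ℝ) * τ.q₀ ^ 2 / 2 ≤ ∑ w ∈ τ.gen n, τ.size w ^ 2 := le_sum_size_sq n
      _ ≤ ∑ w ∈ τ.gen n, ∑ j ∈ J', τ.massIn ρ (Metric.ball (z j) (r j)) 0 n w := by
          refine Finset.sum_le_sum fun w hw => ?_
          have hc : τ.center ρ w ∈ τ.inner ρ w :=
            Metric.mem_closedBall_self (hρ.radius_pos hw).le
          obtain ⟨j, hj, hcj⟩ := mem_iUnion₂.1 (hcov' (mem_biUnion hw hc))
          refine le_trans ?_ (Finset.single_le_sum (f := fun j =>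
            τ.massIn ρ (Metric.ball (z j) (r j)) 0 n w) (fun i _ => ?_) hj)
          · simp only [massIn]
            rw [if_pos ⟨_, hc, hcj⟩]
          · simp only [massIn]
            split_ifs <;> positivity
      _ = ∑ j ∈ J', ∑ w ∈ τ.gen n, τ.massIn ρ (Metric.ball (z j) (r j)) 0 n w :=
          Finset.sum_comm
      _ ≤ _ := by
          refine Finset.sum_le_sum fun j hj => ?_
          have h1 := hJpos j hj
          have h2 := (hr j).2
          exact hρ.sum_massIn_le h1 (by linarith) (mul_nonneg hC.le (hg _ h1 h2))
            (hsmall _ h1 h2) (hbig _ h1 h2) (hn j hj)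
  have key' : τ.base.card * τ.q₀ ^ 2 / (18 * C) ≤ ∑ j ∈ J', g (2 * r j) := by
    rw [div_le_iff₀ (by positivity)]
    rw [← Finset.mul_sum, ← Finset.mul_sum] at key
    linarith
  calc ENNReal.ofReal (τ.base.card * τ.q₀ ^ 2 / (18 * C))
      ≤ ENNReal.ofReal (∑ j ∈ J', g (2 * r j)) := ENNReal.ofReal_le_ofReal key'
    _ = ∑ j ∈ J', ENNReal.ofReal (g (2 * r j)) :=
        ENNReal.ofReal_sum_of_nonneg fun j hj => hg _ (hJpos j hj) (hr j).2
    _ ≤ _ := ENNReal.sum_le_tsum J'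

theorem gaugeHausdorff_limitSet_le (hρ : τ.IsRadius ρ) {g : ℝ → ℝ} {C δ₀ : ℝ} (hδ₀ : 0 < δ₀)
    (hg0 : g 0 = 0) (hg : ∀ q ∈ Ioc 0 τ.q₀, 4 * ρ q < δ₀ → g (4 * ρ q) ≤ C * q ^ 2) (hC : 0 ≤ C) :
    gaugeHausdorff g (τ.limitSet ρ) ≤ ENNReal.ofReal (C * (τ.base.card * τ.q₀ ^ 2)) := by
  classical
  refine iSup₂_le fun δ hδ => ?_
  obtain ⟨n, hn⟩ : ∃ n : ℕ, τ.q₀ * (1 / 2) ^ n < min δ δ₀ / 4 := by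
    have ht : Tendsto (fun n : ℕ => τ.q₀ * (1 / 2 : ℝ) ^ n) atTop (𝓝 0) := by
      simpa using (tendsto_pow_atTop_nhds_zero_of_lt_one (r := (1 / 2 : ℝ)) (by norm_num)
        (by norm_num)).const_mul τ.q₀
    exact (ht.eventually (gt_mem_nhds (by positivity))).exists
  have hrad : ∀ w ∈ τ.gen n, 4 * ρ (τ.size w) < min δ δ₀ := fun w hw => by
    linarith [hρ.radius_le hw]
  set e := (τ.gen n).equivFin
  let z : ℕ → ℂ := fun j => if h : j < (τ.gen n).card then τ.center ρ (e.symm ⟨j, h⟩) else 0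
  -- The radius is doubled so that open disks cover the closed cells, whence `4 * ρ q` in the
  -- hypothesis. Indices beyond the number of cells give empty disks of cost `g 0 = 0`.
  let r : ℕ → ℝ := fun j =>
    if h : j < (τ.gen n).card then 2 * ρ (τ.size (e.symm ⟨j, h⟩ : List (ℂ × ℝ))) else 0
  refine (iInf₂_le z r).trans ((iInf₂_le (fun j => ?_) fun x hx => ?_).trans ?_)
  · simp only [r]
    split_ifs with h
    · have hw := (e.symm ⟨j, h⟩).2
      have := hrad _ hw
      have h1 := hρ.radius_pos hw
      have h2 := min_le_left δ δ₀
      constructor <;> linarith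
    · simp [hδ]
  · obtain ⟨w, hw, hxw⟩ := mem_iUnion₂.1 (mem_iInter.1 hx n)
    refine mem_iUnion.2 ⟨e ⟨w, hw⟩, ?_⟩
    simp only [z, r, (e ⟨w, hw⟩).2, dite_true, Fin.eta, Equiv.symm_apply_apply]
    refine Metric.closedBall_subset_ball ?_ hxw
    linarith [hρ.radius_pos hw]
  · rw [tsum_eq_sum (s := Finset.range (τ.gen n).card) (fun j hj => by
      simp only [r, dif_neg (mt Finset.mem_range.2 hj), mul_zero, hg0, ENNReal.ofReal_zero]),
      Finset.sum_range]
    have h1 : ∀ i : Fin (τ.gen n).card, ENNReal.ofReal (g (2 * r i)) ≤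
        ENNReal.ofReal (C * τ.size (e.symm i : List (ℂ × ℝ)) ^ 2) := by
      intro i
      have hw := (e.symm i).2
      refine ENNReal.ofReal_le_ofReal ?_
      have := hg _ (size_mem' hw) ((hrad _ hw).trans_le (min_le_right _ _))
      simp only [r, i.2, dite_true, Fin.eta]
      rwa [← mul_assoc, show (2 : ℝ) * 2 = 4 by norm_num]
    refine (Finset.sum_le_sum fun i _ => h1 i).trans ?_
    rw [← ENNReal.ofReal_sum_of_nonneg fun i _ => by positivity]
    refine ENNReal.ofReal_le_ofReal ?_
    rw [← Finset.mul_sum, Equiv.sum_comp e.symm fun w => τ.size (w : List (ℂ × ℝ)) ^ 2,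
      Finset.sum_coe_sort (τ.gen n) fun w => τ.size w ^ 2]
    exact mul_le_mul_of_nonneg_left (sum_size_sq_le n) hC

end IsRadius
end DiskTree

/-! ### Distortion, area and weak derivatives. -/

/-- `f` is differentiable at `z` and its directional derivatives differ at most by the factor
`K`. -/
def HasDistortionAt (K : ℝ) (f : ℂ → ℂ) (z : ℂ) : Prop :=
  DifferentiableAt ℝ f z ∧
    ∀ u v : ℂ, ‖u‖ = 1 → ‖v‖ = 1 → ‖fderiv ℝ f z u‖ ≤ K * ‖fderiv ℝ f z v‖

theorem Complex.det_realLinear (D : ℂ →L[ℝ] ℂ) :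
    D.det = (D 1).re * (D Complex.I).im - (D 1).im * (D Complex.I).re := by
  rw [ContinuousLinearMap.det, ← LinearMap.det_toMatrix Complex.basisOneI, Matrix.det_fin_two]
  simp [LinearMap.toMatrix_apply, mul_comm]

/-- In the form `D z = α z + β z̄`, the extreme stretchings are `‖α‖ + ‖β‖` and `|‖α‖ - ‖β‖|`, and
their product is `|det D|`. -/
theorem Complex.norm_sq_le_mul_det {K : ℝ} (D : ℂ →L[ℝ] ℂ)
    (hD : ∀ u v : ℂ, ‖u‖ = 1 → ‖v‖ = 1 → ‖D u‖ ≤ K * ‖D v‖) : ‖D‖ ^ 2 ≤ K * |D.det| := by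
  set α : ℂ := (D 1 - Complex.I * D Complex.I) / 2 with hα
  set β : ℂ := (D 1 + Complex.I * D Complex.I) / 2 with hβ
  have hDz : ∀ z : ℂ, D z = α * z + β * (starRingEnd ℂ) z := by
    intro z
    have h1 : D z = z.re • D 1 + z.im • D Complex.I := by
      rw [← map_smul, ← map_smul, ← map_add]
      congr 1
      simp [Complex.re_add_im]
    have h2 : (z.re : ℂ) + z.im * Complex.I = z := Complex.re_add_im z
    have h3 : (starRingEnd ℂ) z = z.re - z.im * Complex.I := by
      apply Complex.ext <;> simp
    rw [h1, h3, hα, hβ]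
    nth_rewrite 3 [← h2]
    simp only [Complex.real_smul]
    linear_combination ((z.im : ℂ) * D Complex.I) * Complex.I_sq
  have hdet : D.det = ‖α‖ ^ 2 - ‖β‖ ^ 2 := by
    rw [Complex.det_realLinear, ← Complex.normSq_eq_norm_sq, ← Complex.normSq_eq_norm_sq,
      Complex.normSq_apply, Complex.normSq_apply, hα, hβ]
    simp
    ring
  have hle : ‖D‖ ≤ ‖α‖ + ‖β‖ := by
    refine D.opNorm_le_bound (by positivity) fun z => ?_
    rw [hDz]
    refine (norm_add_le _ _).trans ?_
    rw [norm_mul, norm_mul, RCLike.norm_conj, add_mul]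
  -- At this angle `α u` and `β ū` have the same argument, giving the maximal stretching; after a
  -- quarter turn they are opposed, giving the minimal one.
  set θ : ℝ := (β.arg - α.arg) / 2
  set e : ℂ := Complex.exp ((((α.arg + β.arg) / 2 : ℝ) : ℂ) * Complex.I) with he
  set u : ℂ := Complex.exp ((θ : ℂ) * Complex.I) with hu
  have hen : ‖e‖ = 1 := Complex.norm_exp_ofReal_mul_I _
  have hun : ‖u‖ = 1 := Complex.norm_exp_ofReal_mul_I _
  have h1 : α * u = ‖α‖ * e := by
    conv_lhs => rw [← Complex.norm_mul_exp_arg_mul_I α]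
    rw [mul_assoc, hu, ← Complex.exp_add, he]
    congr 2
    simp only [θ]
    push_cast
    ring
  have h2 : β * (starRingEnd ℂ) u = ‖β‖ * e := by
    conv_lhs => rw [← Complex.norm_mul_exp_arg_mul_I β]
    rw [mul_assoc, hu, ← Complex.exp_conj, ← Complex.exp_add, he]
    congr 2
    simp only [θ, map_mul, Complex.conj_ofReal, Complex.conj_I]
    push_cast
    ring
  have h3 : ‖D u‖ = ‖α‖ + ‖β‖ := by
    rw [hDz, h1, h2, ← add_mul, norm_mul, hen, mul_one, ← Complex.ofReal_add, Complex.norm_real,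
      Real.norm_of_nonneg (by positivity)]
  have h4 : ‖D (Complex.I * u)‖ = |‖α‖ - ‖β‖| := by
    have : α * (Complex.I * u) + β * (starRingEnd ℂ) (Complex.I * u) =
        Complex.I * (((‖α‖ - ‖β‖ : ℝ) : ℂ) * e) := by
      rw [map_mul, Complex.conj_I]
      push_cast
      linear_combination Complex.I * h1 - Complex.I * h2
    rw [hDz, this, norm_mul, norm_mul, hen, Complex.norm_I, one_mul, mul_one, Complex.norm_real,
      Real.norm_eq_abs]
  have h5 := hD u (Complex.I * u) hun (by rw [norm_mul, hun, Complex.norm_I, mul_one])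
  rw [h3, h4] at h5
  have h6 : |D.det| = |‖α‖ - ‖β‖| * (‖α‖ + ‖β‖) := by
    rw [hdet, show ‖α‖ ^ 2 - ‖β‖ ^ 2 = (‖α‖ - ‖β‖) * (‖α‖ + ‖β‖) by ring, abs_mul,
      abs_of_nonneg (by positivity : 0 ≤ ‖α‖ + ‖β‖)]
  rw [h6]
  calc ‖D‖ ^ 2 ≤ (‖α‖ + ‖β‖) * (‖α‖ + ‖β‖) := by
        rw [sq]; exact mul_le_mul hle hle (norm_nonneg _) (by positivity)
    _ ≤ K * |‖α‖ - ‖β‖| * (‖α‖ + ‖β‖) := mul_le_mul_of_nonneg_right h5 (by positivity)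
    _ = _ := by ring

/-- The Dirichlet integral of an injective map of bounded distortion is controlled by the area of
its image. -/
theorem lintegral_fderiv_sq_le {K : ℝ} {f : ℂ → ℂ} (hf : Function.Injective f)
    (hd : ∀ᵐ z, HasDistortionAt K f z) {s : Set ℂ} (hs : MeasurableSet s) :
    ∫⁻ z in s, ‖fderiv ℝ f z‖ₑ ^ 2 ≤ ENNReal.ofReal K * volume (f '' s) := by
  set s' := s ∩ {z | DifferentiableAt ℝ f z} with hs'
  have hm : MeasurableSet s' := hs.inter (measurableSet_of_differentiableAt ℝ f)
  have hae : s' =ᵐ[volume] s := by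
    refine inter_ae_eq_left_of_ae_eq_univ ?_
    exact eventuallyEq_univ.2 (hd.mono fun z hz => hz.1)
  rw [← setLIntegral_congr hae]
  calc ∫⁻ z in s', ‖fderiv ℝ f z‖ₑ ^ 2
      ≤ ∫⁻ z in s', ENNReal.ofReal K * ENNReal.ofReal |(fderiv ℝ f z).det| := by
        refine lintegral_mono_ae (ae_restrict_of_ae (hd.mono fun z hz => ?_))
        rcases le_or_gt 0 K with hK | hK
        · rw [← ENNReal.ofReal_mul hK, ← ofReal_norm,
            ← ENNReal.ofReal_pow (norm_nonneg _)]
          exact ENNReal.ofReal_le_ofReal (Complex.norm_sq_le_mul_det _ hz.2)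
        · have h1 := Complex.norm_sq_le_mul_det _ hz.2
          have h2 : ‖fderiv ℝ f z‖ ^ 2 ≤ 0 :=
            h1.trans (mul_nonpos_of_nonpos_of_nonneg hK.le (abs_nonneg _))
          have h3 : fderiv ℝ f z = 0 :=
            norm_eq_zero.1 (pow_eq_zero_iff (two_ne_zero)|>.1 (le_antisymm h2 (sq_nonneg _)))
          simp [h3]
    _ = ENNReal.ofReal K * volume (f '' s') := by
        rw [lintegral_const_mul' _ _ ENNReal.ofReal_ne_top,
          lintegral_abs_det_fderiv_eq_addHaar_image volume hm
            (fun z hz => hz.2.hasFDerivAt.hasFDerivWithinAt) hf.injOn]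
    _ ≤ _ := by
        gcongr
        exact inter_subset_left

theorem eLpNorm_fderiv_le {K : ℝ} {f : ℂ → ℂ} (hf : Function.Injective f)
    (hd : ∀ᵐ z, HasDistortionAt K f z) {s : Set ℂ} (hs : MeasurableSet s) :
    eLpNorm (fderiv ℝ f) 2 (volume.restrict s) ≤
      (ENNReal.ofReal K * volume (f '' s)) ^ (1 / 2 : ℝ) := by
  rw [eLpNorm_eq_lintegral_rpow_enorm_toReal (by norm_num) (by norm_num)]
  simp only [ENNReal.toReal_ofNat, ENNReal.rpow_ofNat]
  gcongr
  exact lintegral_fderiv_sq_le hf hd hs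

/-- Cauchy–Schwarz: on a set of small area whose image has bounded area, the derivative has small
integral. -/
theorem lintegral_fderiv_le {K : ℝ} {f : ℂ → ℂ} (hf : Function.Injective f)
    (hd : ∀ᵐ z, HasDistortionAt K f z) {s : Set ℂ} (hs : MeasurableSet s) :
    ∫⁻ z in s, ‖fderiv ℝ f z‖ₑ ≤
      (ENNReal.ofReal K * volume (f '' s)) ^ (1 / 2 : ℝ) * volume s ^ (1 / 2 : ℝ) := by
  have h := eLpNorm_le_eLpNorm_mul_rpow_measure_univ (μ := volume.restrict s) (p := 1) (q := 2)
    (f := fderiv ℝ f) (by norm_num) (measurable_fderiv ℝ f).aestronglyMeasurable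
  rw [eLpNorm_one_eq_lintegral_enorm, Measure.restrict_apply_univ] at h
  refine h.trans ?_
  norm_num
  gcongr
  simpa using eLpNorm_fderiv_le hf hd hs

theorem memL2Loc_fderiv {K : ℝ} (f : ℂ ≃ₜ ℂ) (hd : ∀ᵐ z, HasDistortionAt K f z) :
    MemL2Loc (fderiv ℝ f) := by
  intro s hs
  refine ⟨(measurable_fderiv ℝ f).aestronglyMeasurable, ?_⟩
  refine (eLpNorm_fderiv_le f.injective hd hs.measurableSet).trans_lt ?_
  exact ENNReal.rpow_lt_top_of_nonneg (by norm_num)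
    (ENNReal.mul_ne_top ENNReal.ofReal_ne_top (hs.image f.continuous).measure_lt_top.ne)

theorem memL2Loc_of_continuous {f : ℂ → ℂ} (hf : Continuous f) : MemL2Loc f := by
  intro s hs
  have : IsFiniteMeasure (volume.restrict s) := ⟨by simpa using hs.measure_lt_top⟩
  obtain ⟨C, hC⟩ := hs.exists_bound_of_continuousOn hf.continuousOn
  exact MemLp.of_bound hf.aestronglyMeasurable C
    ((ae_restrict_iff' hs.measurableSet).2 (Eventually.of_forall hC))

theorem MemL2Loc.locallyIntegrable {F : Type*} [NormedAddCommGroup F] {f : ℂ → F}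
    (hf : MemL2Loc f) : LocallyIntegrable f := by
  rw [locallyIntegrable_iff]
  intro s hs
  have : IsFiniteMeasure (volume.restrict s) := ⟨by simpa using hs.measure_lt_top⟩
  exact (hf s hs).integrable (by norm_num)

/-- By Rademacher's theorem the pointwise derivative exists a.e.; integration by parts is applied to
real linear functionals of `f`, then to its real and imaginary parts. -/
theorem LipschitzWith.integral_smul_fderiv {f : ℂ → ℂ} {C : NNReal} (hf : LipschitzWith C f)
    {η : ℂ → ℝ} (hη : ContDiff ℝ (⊤ : ℕ∞) η) (hηc : HasCompactSupport η) (v : ℂ) :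
    ∫ w, η w • fderiv ℝ f w v = -∫ w, (fderiv ℝ η w v) • f w := by
  obtain ⟨B, hB⟩ := hη.lipschitzWith_of_hasCompactSupport hηc (by simp)
  have hηd : Differentiable ℝ η := hη.differentiable (by simp)
  have hfd := hf.ae_differentiableAt (μ := volume)
  have key : ∀ L : ℂ →L[ℝ] ℝ, ∫ w, η w * L (fderiv ℝ f w v) = -∫ w, fderiv ℝ η w v * L (f w) := by
    intro L
    have h1 := (L.lipschitz.comp hf).integral_lineDeriv_mul_eq (μ := volume) hB hηc v
    have h2 : ∫ w, lineDeriv ℝ (L ∘ f) w v * η w = ∫ w, η w * L (fderiv ℝ f w v) := by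
      refine integral_congr_ae (hfd.mono fun w hw => ?_)
      have : HasFDerivAt (L ∘ f) (L.comp (fderiv ℝ f w)) w :=
        L.hasFDerivAt.comp w hw.hasFDerivAt
      simp only [this.differentiableAt.lineDeriv_eq_fderiv, this.fderiv]
      simp [mul_comm]
    rw [← h2, h1, ← integral_neg]
    refine integral_congr_ae (Eventually.of_forall fun w => ?_)
    simp [(hηd w).lineDeriv_eq_fderiv]
  have hi1 : Integrable fun w => η w • fderiv ℝ f w v := by
    refine Integrable.mono' (g := fun w => (C * ‖v‖) * ‖η w‖)
      ((hη.continuous.integrable_of_hasCompactSupport hηc).norm.const_mul _) ?_ ?_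
    · exact hη.continuous.aestronglyMeasurable.smul
        (measurable_fderiv_apply_const ℝ f v).aestronglyMeasurable
    · refine Eventually.of_forall fun w => ?_
      rw [norm_smul, mul_comm]
      gcongr
      exact (ContinuousLinearMap.le_opNorm _ _).trans
        (by gcongr; exact norm_fderiv_le_of_lipschitz ℝ hf)
  have hc : HasCompactSupport fun w => fderiv ℝ η w v := hηc.fderiv_apply ℝ v
  have hi2 : Integrable fun w => (fderiv ℝ η w v) • f w :=
    (Continuous.smul ((hη.continuous_fderiv (by simp)).clm_apply continuous_const)
      hf.continuous).integrable_of_hasCompactSupport hc.smul_right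
  apply Complex.ext
  · have h := key Complex.reCLM
    rw [Complex.neg_re]
    have e1 := Complex.reCLM.integral_comp_comm hi1
    have e2 := Complex.reCLM.integral_comp_comm hi2
    simp only [Complex.reCLM_apply] at e1 e2
    rw [← e1, ← e2]
    simpa using h
  · have h := key Complex.imCLM
    rw [Complex.neg_im]
    have e1 := Complex.imCLM.integral_comp_comm hi1
    have e2 := Complex.imCLM.integral_comp_comm hi2
    simp only [Complex.imCLM_apply] at e1 e2
    rw [← e1, ← e2]
    simpa using h

/-- A limit of Lipschitz homeomorphisms of bounded distortion, which differ from their limit only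
on sets of small area, is quasiconformal. -/
theorem isQuasiconformal_of_tendsto {K : ℝ} (φ : ℂ ≃ₜ ℂ) (Φ : ℕ → ℂ ≃ₜ ℂ)
    (hlip : ∀ n, ∃ C, LipschitzWith C (Φ n))
    (hunif : TendstoUniformly (fun n z => Φ n z) φ atTop)
    {R : ℝ} (hφR : ∀ z, R < ‖z‖ → φ z = z)
    (hdΦ : ∀ n, ∀ᵐ z, HasDistortionAt K (Φ n) z) (hdφ : ∀ᵐ z, HasDistortionAt K φ z)
    {A : ℕ → Set ℂ} (hA : ∀ n, MeasurableSet (A n))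
    (hAvol : Tendsto (fun n => volume (A n)) atTop (𝓝 0))
    (heq : ∀ n, ∀ z ∉ A n, fderiv ℝ φ z = fderiv ℝ (Φ n) z)
    {B : Set ℂ} (hB : volume B ≠ ∞) (hΦB : ∀ n, Φ n '' A n ⊆ B) (hφB : ∀ n, φ '' A n ⊆ B) :
    IsQuasiconformal K φ := by
  have hL2 := memL2Loc_fderiv φ hdφ
  refine ⟨OrientationPreserving.of_eq_self_outside φ R hφR, memL2Loc_of_continuous φ.continuous,
    fderiv ℝ φ, ⟨φ.continuous.locallyIntegrable, hL2.locallyIntegrable, ?_⟩, hL2,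
    hdφ.mono fun z hz => hz.2⟩
  intro η hη hηc v
  obtain ⟨M, hM⟩ := hη.continuous.bounded_above_of_compact_support hηc
  have hηi : ∀ {f : ℂ → ℂ}, LocallyIntegrable f → Integrable fun w => η w • f w := fun hf =>
    hf.integrable_smul_left_of_hasCompactSupport hη.continuous hηc
  have hloc : ∀ f : ℂ ≃ₜ ℂ, (∀ᵐ z, HasDistortionAt K f z) →
      Integrable fun w => η w • fderiv ℝ f w v := fun f hf =>
    hηi (locallyIntegrable_iff.2 fun _ hs => (ContinuousLinearMap.apply ℝ ℂ v).integrable_comp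
      ((memL2Loc_fderiv f hf).locallyIntegrable.integrableOn_isCompact hs))
  have hlim1 : Tendsto (fun n => ∫ w, (fderiv ℝ η w v) • Φ n w) atTop
      (𝓝 (∫ w, (fderiv ℝ η w v) • φ w)) := by
    have hc : HasCompactSupport fun w => fderiv ℝ η w v := hηc.fderiv_apply ℝ v
    have hcont : Continuous fun w => fderiv ℝ η w v :=
      (hη.continuous_fderiv (by simp)).clm_apply continuous_const
    refine tendsto_integral_filter_of_dominated_convergence
      (fun w => ‖fderiv ℝ η w v‖ * (‖φ w‖ + 1)) ?_ ?_ ?_ ?_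
    · exact Eventually.of_forall fun n => (hcont.smul (Φ n).continuous).aestronglyMeasurable
    · filter_upwards [Metric.tendstoUniformly_iff.1 hunif 1 one_pos] with n hn
      refine Eventually.of_forall fun w => ?_
      rw [norm_smul]
      gcongr
      have h1 := (hn w).le
      rw [dist_comm, dist_eq_norm] at h1
      linarith [norm_le_insert' (Φ n w) (φ w)]
    · exact (Continuous.mul hcont.norm (φ.continuous.norm.add
        continuous_const)).integrable_of_hasCompactSupport hc.norm.mul_right
    · exact Eventually.of_forall fun w =>
        (hunif.tendsto_at w).const_smul _
  -- The two derivatives differ only on `A n`, where both integrals are at most a constant times the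
  -- square root of the area of `A n`.
  have hlim2 : Tendsto (fun n => ∫ w, η w • fderiv ℝ (Φ n) w v) atTop
      (𝓝 (∫ w, η w • fderiv ℝ φ w v)) := by
    rw [tendsto_iff_edist_tendsto_0]
    set c : ℝ≥0∞ := (ENNReal.ofReal K * volume B) ^ (1 / 2 : ℝ)
    have hctop : c ≠ ∞ := (ENNReal.rpow_lt_top_of_nonneg (by norm_num)
      (ENNReal.mul_ne_top ENNReal.ofReal_ne_top hB)).ne
    have hbound : ∀ n, edist (∫ w, η w • fderiv ℝ (Φ n) w v) (∫ w, η w • fderiv ℝ φ w v) ≤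
        ENNReal.ofReal (M * ‖v‖) * (2 * c) * volume (A n) ^ (1 / 2 : ℝ) := by
      intro n
      rw [edist_eq_enorm_sub, ← integral_sub (hloc _ (hdΦ n)) (hloc _ hdφ)]
      refine (enorm_integral_le_lintegral_enorm _).trans ?_
      have hpt : ∀ w, ‖η w • fderiv ℝ (Φ n) w v - η w • fderiv ℝ φ w v‖ₑ ≤
          (A n).indicator (fun w => ENNReal.ofReal (M * ‖v‖) *
            (‖fderiv ℝ (Φ n) w‖ₑ + ‖fderiv ℝ φ w‖ₑ)) w := by
        intro w
        by_cases hw : w ∈ A n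
        · rw [indicator_of_mem hw, ← smul_sub, ← sub_apply, enorm_smul,
            ENNReal.ofReal_mul ((norm_nonneg _).trans (hM w)), ofReal_norm, mul_assoc]
          refine mul_le_mul' ?_ ?_
          · rw [← ofReal_norm]
            exact ENNReal.ofReal_le_ofReal (hM w)
          · rw [mul_comm]
            refine (ContinuousLinearMap.le_opENorm _ _).trans ?_
            gcongr
            exact enorm_sub_le
        · rw [indicator_of_notMem hw, heq n w hw]
          simp
      refine (lintegral_mono hpt).trans ?_
      have hmeas : Measurable fun w => ‖fderiv ℝ (Φ n) w‖ₑ := (measurable_fderiv ℝ _).enorm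
      rw [lintegral_indicator (hA n), lintegral_const_mul' _ _ ENNReal.ofReal_ne_top,
        lintegral_add_left hmeas, mul_assoc]
      gcongr
      have h1 := lintegral_fderiv_le (Φ n).injective (hdΦ n) (hA n)
      have h2 := lintegral_fderiv_le φ.injective hdφ (hA n)
      calc _ ≤ c * volume (A n) ^ (1 / 2 : ℝ) + c * volume (A n) ^ (1 / 2 : ℝ) := by
            refine add_le_add (h1.trans ?_) (h2.trans ?_)
            · simp only [c]
              gcongr
              exact hΦB n
            · simp only [c]
              gcongr
              exact hφB n
        _ = _ := by ring
    refine tendsto_of_tendsto_of_tendsto_of_le_of_le tendsto_const_nhds ?_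
      (fun _ => zero_le) hbound
    have h0 : Tendsto (fun n => volume (A n) ^ (1 / 2 : ℝ)) atTop (𝓝 0) := by
      have := (ENNReal.continuous_rpow_const (y := (1 / 2 : ℝ))).tendsto 0 |>.comp hAvol
      simpa [Function.comp_def] using this
    have := ENNReal.Tendsto.const_mul (a := ENNReal.ofReal (M * ‖v‖) * (2 * c)) h0
      (Or.inr (ENNReal.mul_ne_top ENNReal.ofReal_ne_top (ENNReal.mul_ne_top (by simp) hctop)))
    simpa using this
  refine tendsto_nhds_unique hlim2 ?_
  refine (hlim1.neg).congr fun n => ?_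
  obtain ⟨C, hC⟩ := hlip n
  exact (hC.integral_smul_fderiv hη hηc v).symm

theorem HasDistortionAt.of_hasFDerivAt {K : ℝ} {f : ℂ → ℂ} {z : ℂ} {D : ℂ →L[ℝ] ℂ}
    (hf : HasFDerivAt f D z) (hD : ∀ u v : ℂ, ‖u‖ = 1 → ‖v‖ = 1 → ‖D u‖ ≤ K * ‖D v‖) :
    HasDistortionAt K f z :=
  ⟨hf.differentiableAt, by rwa [hf.fderiv]⟩

theorem HasDistortionAt.congr_of_eventuallyEq {K : ℝ} {f g : ℂ → ℂ} {z : ℂ}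
    (hf : HasDistortionAt K f z) (h : g =ᶠ[𝓝 z] f) : HasDistortionAt K g z :=
  .of_hasFDerivAt (hf.1.hasFDerivAt.congr_of_eventuallyEq h) hf.2

/-- Postcomposition with a similarity does not change the distortion. -/
theorem HasDistortionAt.affine {K : ℝ} {f : ℂ → ℂ} {z : ℂ} (hf : HasDistortionAt K f z)
    (a b : ℂ) (c : ℝ) : HasDistortionAt K (fun w => b + c • (f w - a)) z := by
  refine .of_hasFDerivAt (((hf.1.hasFDerivAt.sub_const a).const_smul c).const_add b)
    fun u v hu hv => ?_
  simp only [smul_apply, norm_smul]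
  calc ‖c‖ * ‖fderiv ℝ f z u‖ ≤ ‖c‖ * (K * ‖fderiv ℝ f z v‖) := by
        gcongr; exact hf.2 u v hu hv
    _ = _ := by ring

theorem hasDistortionAt_id {K : ℝ} (hK : 1 ≤ K) (z : ℂ) : HasDistortionAt K (fun w => w) z :=
  .of_hasFDerivAt (hasFDerivAt_id z) fun u v hu hv => by simp [hu, hv, hK]

/-! ### Radial stretching of one annulus. -/

/-- The radial map `x ↦ x (‖x‖ / o) ^ p` of the annulus `i ≤ ‖x‖ ≤ o`, extended by a homothety
inside and by the identity outside. -/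
noncomputable def clampStretch (p i o : ℝ) (x : ℂ) : ℂ := (max i (min ‖x‖ o) / o) ^ p • x

section clampStretch

variable {p p' i o : ℝ}

theorem clampStretch_of_ge (hi : 0 < i) (hio : i ≤ o) {x : ℂ} (hx : o ≤ ‖x‖) :
    clampStretch p i o x = x := by
  rw [clampStretch, min_eq_right hx, max_eq_right hio, div_self (hi.trans_le hio).ne',
    Real.one_rpow, one_smul]

theorem clampStretch_of_le {x : ℂ} (hio : i ≤ o) (hx : ‖x‖ ≤ i) :
    clampStretch p i o x = (i / o) ^ p • x := by
  rw [clampStretch, min_eq_left (hx.trans hio), max_eq_left hx]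

theorem clampStretch_of_mem {x : ℂ} (hi : i ≤ ‖x‖) (ho : ‖x‖ ≤ o) :
    clampStretch p i o x = (‖x‖ / o) ^ p • x := by
  rw [clampStretch, min_eq_left ho, max_eq_right hi]

theorem norm_clampStretch_of_mem {x : ℂ} (hi0 : 0 < i) (hi : i ≤ ‖x‖) (ho : ‖x‖ ≤ o) :
    ‖clampStretch p i o x‖ = o * (‖x‖ / o) ^ (1 + p) := by
  have hx : 0 < ‖x‖ := hi0.trans_le hi
  have ho' : 0 < o := hx.trans_le ho
  rw [clampStretch_of_mem hi ho, norm_smul, Real.norm_of_nonneg (by positivity),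
    Real.rpow_add (by positivity), Real.rpow_one]
  field_simp

theorem norm_clampStretch_le_of_le {x : ℂ} (hi0 : 0 < i) (hio : i ≤ o) (hx : ‖x‖ ≤ i) :
    ‖clampStretch p i o x‖ ≤ o * (i / o) ^ (1 + p) := by
  have ho' : 0 < o := hi0.trans_le hio
  rw [clampStretch_of_le hio hx, norm_smul, Real.norm_of_nonneg (by positivity),
    Real.rpow_add (by positivity), Real.rpow_one]
  calc (i / o) ^ p * ‖x‖ ≤ (i / o) ^ p * i := by gcongr
    _ = _ := by field_simp

theorem norm_clampStretch_le (hi : 0 < i) (hio : i ≤ o) (hp : 0 < 1 + p) {x : ℂ}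
    (hx : ‖x‖ ≤ o) : ‖clampStretch p i o x‖ ≤ o := by
  have ho' : 0 < o := hi.trans_le hio
  rcases le_total ‖x‖ i with h | h
  · exact (norm_clampStretch_le_of_le hi hio h).trans (mul_le_of_le_one_right ho'.le
      (Real.rpow_le_one (by positivity) ((div_le_one ho').2 hio) hp.le))
  · rw [norm_clampStretch_of_mem hi h hx]
    exact mul_le_of_le_one_right ho'.le
      (Real.rpow_le_one (by positivity) ((div_le_one ho').2 hx) hp.le)

/-- On the annulus the modulus relative to `o` is raised to the power `1 + p`, so reciprocal
exponents, with the inner radius replaced by its image, give inverse maps. -/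
theorem clampStretch_clampStretch (hi : 0 < i) (hio : i ≤ o) (hp : 0 < 1 + p)
    (hpp : (1 + p) * (1 + p') = 1) (x : ℂ) :
    clampStretch p' (o * (i / o) ^ (1 + p)) o (clampStretch p i o x) = x := by
  have ho : 0 < o := hi.trans_le hio
  have hi' : 0 < o * (i / o) ^ (1 + p) := by positivity
  have hio' : o * (i / o) ^ (1 + p) ≤ o := mul_le_of_le_one_right ho.le
    (Real.rpow_le_one (by positivity) ((div_le_one ho).2 hio) hp.le)
  have hexp : (1 + p) * p' + p = 0 := by linear_combination hpp
  rcases le_total o ‖x‖ with hx | hx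
  · rw [clampStretch_of_ge hi hio hx, clampStretch_of_ge hi' hio' hx]
  rcases le_total ‖x‖ i with h | h
  · rw [clampStretch_of_le hio' (norm_clampStretch_le_of_le hi hio h), clampStretch_of_le hio h,
      smul_smul, mul_div_cancel_left₀ _ ho.ne', ← Real.rpow_mul (by positivity),
      ← Real.rpow_add (by positivity), hexp, Real.rpow_zero, one_smul]
  · have hx0 : 0 < ‖x‖ := hi.trans_le h
    have hn := norm_clampStretch_of_mem (p := p) hi h hx
    rw [clampStretch_of_mem (by rw [hn]; gcongr) (norm_clampStretch_le hi hio hp hx), hn,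
      clampStretch_of_mem h hx, smul_smul, mul_div_cancel_left₀ _ ho.ne',
      ← Real.rpow_mul (by positivity), ← Real.rpow_add (by positivity), hexp, Real.rpow_zero,
      one_smul]

theorem continuous_clampStretch (hi : 0 < i) (hio : i ≤ o) : Continuous (clampStretch p i o) := by
  have ho : 0 < o := hi.trans_le hio
  refine Continuous.smul (Continuous.rpow_const (by fun_prop) fun x => Or.inl ?_) continuous_id
  have : 0 < max i (min ‖x‖ o) := hi.trans_le (le_max_left _ _)
  positivity

/-- The displacement is `(m ‖x‖ - 1) • x` with `m` Lipschitz, because clamping keeps the base of the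
power at least `i / o`. As it vanishes outside the disk, the growth of `x` does no harm. -/
theorem exists_lipschitzWith_clampStretch_sub (hi : 0 < i) (hio : i ≤ o) (hp : p ≤ 1) :
    ∃ C, LipschitzWith C fun x => clampStretch p i o x - x := by
  have ho : 0 < o := hi.trans_le hio
  set c : ℝ := i / o with hc
  have hc0 : 0 < c := by positivity
  set L : ℝ := |p| * c ^ (p - 1) with hL
  have hL0 : 0 ≤ L := by positivity
  have hpow : ∀ s ∈ Ici c, ∀ t ∈ Ici c, |s ^ p - t ^ p| ≤ L * |s - t| := by
    intro s hs t ht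
    refine (convex_Ici c).norm_image_sub_le_of_norm_hasDerivWithin_le
      (f := fun x => x ^ p) (f' := fun x => p * x ^ (p - 1)) (fun x hx => ?_) (fun x hx => ?_) ht hs
    · exact (Real.hasDerivAt_rpow_const (Or.inl (hc0.trans_le hx).ne')).hasDerivWithinAt
    · have hx' : 0 < x := hc0.trans_le hx
      rw [norm_mul, Real.norm_eq_abs, Real.norm_of_nonneg (by positivity), hL]
      exact mul_le_mul_of_nonneg_left
        (Real.rpow_le_rpow_of_nonpos hc0 hx (by linarith)) (abs_nonneg p)
  let m : ℝ → ℝ := fun t => (max i (min t o) / o) ^ p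
  have hm : ∀ s t : ℝ, |m s - m t| ≤ L / o * |s - t| := by
    intro s t
    have hmem : ∀ t, max i (min t o) / o ∈ Ici c := fun t =>
      div_le_div_of_nonneg_right (le_max_left _ _) ho.le
    refine (hpow _ (hmem s) _ (hmem t)).trans ?_
    rw [← sub_div, abs_div, abs_of_pos ho]
    have : |max i (min s o) - max i (min t o)| ≤ |s - t| := by
      have h1 := abs_max_sub_max_le_max i (min s o) i (min t o)
      have h2 := abs_min_sub_min_le_max s o t o
      simp only [sub_self, abs_zero] at h1 h2
      rw [max_eq_right (abs_nonneg (min s o - min t o))] at h1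
      rw [max_eq_left (abs_nonneg (s - t))] at h2
      exact h1.trans h2
    calc L * (|max i (min s o) - max i (min t o)| / o) ≤ L * (|s - t| / o) := by gcongr
      _ = _ := by ring
  have hmo : ∀ t, o ≤ t → m t = 1 := by
    intro t ht
    simp only [m]
    rw [min_eq_right ht, max_eq_right hio, div_self ho.ne', Real.one_rpow]
  have hm1 : ∀ t, 0 ≤ t → |m t - 1| ≤ L := by
    intro t ht
    rcases le_total o t with h | h
    · simpa [hmo t h] using hL0
    · rw [← hmo o le_rfl]
      refine (hm t o).trans ?_
      have : |t - o| ≤ o := by rw [abs_le]; constructor <;> linarith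
      calc L / o * |t - o| ≤ L / o * o := by gcongr
        _ = L := by field_simp
  have key : ∀ x y : ℂ, ‖y‖ ≤ ‖x‖ →
      ‖(clampStretch p i o x - x) - (clampStretch p i o y - y)‖ ≤ 2 * L * ‖x - y‖ := by
    intro x y hyx
    have e : ∀ x : ℂ, clampStretch p i o x - x = (m ‖x‖ - 1) • x := fun x => by
      rw [sub_smul, one_smul]; rfl
    rcases le_total o ‖y‖ with h | h
    · rw [e, e, hmo _ h, hmo _ (h.trans hyx)]
      simp only [sub_self, zero_smul, norm_zero]
      positivity
    · have : (clampStretch p i o x - x) - (clampStretch p i o y - y) =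
          (m ‖x‖ - 1) • (x - y) + (m ‖x‖ - m ‖y‖) • y := by
        rw [e, e]
        module
      rw [this]
      refine (norm_add_le _ _).trans ?_
      rw [norm_smul, norm_smul, Real.norm_eq_abs, Real.norm_eq_abs]
      have h1 := hm1 ‖x‖ (norm_nonneg x)
      have h2 : |m ‖x‖ - m ‖y‖| ≤ L / o * ‖x - y‖ :=
        (hm _ _).trans (by gcongr; exact abs_norm_sub_norm_le x y)
      calc |m ‖x‖ - 1| * ‖x - y‖ + |m ‖x‖ - m ‖y‖| * ‖y‖
          ≤ L * ‖x - y‖ + L / o * ‖x - y‖ * o := by gcongr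
        _ = _ := by field_simp; ring
  refine ⟨⟨2 * L, by positivity⟩, LipschitzWith.of_dist_le_mul fun x y => ?_⟩
  rw [dist_eq_norm, dist_eq_norm]
  rcases le_total ‖y‖ ‖x‖ with h | h
  · exact key x y h
  · rw [norm_sub_rev, norm_sub_rev x y]
    exact key y x h

/-- The distortion of a radial power map. -/
theorem hasDistortionAt_rpow_smul {K : ℝ} (hK : 1 ≤ K) (ho : 0 < o) {x : ℂ} (hx : x ≠ 0) :
    HasDistortionAt K (fun w : ℂ => (‖w‖ / o) ^ (1 / K - 1) • w) x := by
  have hn : 0 < ‖x‖ := norm_pos_iff.2 hx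
  have hK0 : 0 < K := by linarith
  have hKinv : 0 < 1 / K := by positivity
  have hKle : 1 / K ≤ 1 := (div_le_one hK0).2 hK
  set p := 1 / K - 1 with hp
  have h1 : HasFDerivAt (fun w : ℂ => ‖w‖) (‖x‖⁻¹ • innerSL ℝ x) x := by
    have h := ((hasStrictFDerivAt_norm_sq x).hasFDerivAt).sqrt (by positivity)
    simp only [Real.sqrt_sq (norm_nonneg _)] at h
    have e : (1 / (2 * ‖x‖)) • 2 • innerSL ℝ x = ‖x‖⁻¹ • innerSL ℝ x := by
      rw [← Nat.cast_smul_eq_nsmul ℝ, smul_smul]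
      congr 1
      push_cast
      field_simp
    rwa [e] at h
  have h2 : HasFDerivAt (fun w : ℂ => (‖w‖ / o) ^ p)
      ((p * (‖x‖ / o) ^ (p - 1)) • (o⁻¹ • (‖x‖⁻¹ • innerSL ℝ x))) x := by
    have := (h1.const_mul o⁻¹).rpow_const (p := p) (Or.inl (by positivity))
    simpa only [div_eq_inv_mul] using this
  have h3 := h2.smul (hasFDerivAt_id x)
  set m := (‖x‖ / o) ^ p with hm
  have hm0 : 0 < m := by positivity
  -- Here `s` is the squared cosine of the angle between `u` and `x`. The squared stretching runs
  -- from `m²` tangentially to `m² (1 + p)² = m² / K²` radially.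
  have hnorm : ∀ u : ℂ, ‖u‖ = 1 → ∃ s, 0 ≤ s ∧ s ≤ 1 ∧
      ‖(m • ContinuousLinearMap.id ℝ ℂ + ((p * (‖x‖ / o) ^ (p - 1)) •
        (o⁻¹ • (‖x‖⁻¹ • innerSL ℝ x))).smulRight x) u‖ ^ 2 =
      m ^ 2 * (1 + (2 * p + p ^ 2) * s) := by
    intro u hu
    refine ⟨(inner ℝ x u / ‖x‖) ^ 2, by positivity, ?_, ?_⟩
    · rw [sq_le_one_iff_abs_le_one, abs_div, abs_norm, div_le_one hn]
      simpa [hu] using abs_real_inner_le_norm x u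
    · have e : (m • ContinuousLinearMap.id ℝ ℂ + ((p * (‖x‖ / o) ^ (p - 1)) •
          (o⁻¹ • (‖x‖⁻¹ • innerSL ℝ x))).smulRight x) u =
          m • (u + (p * inner ℝ x u / ‖x‖ ^ 2) • x) := by
        have : (‖x‖ / o) ^ (p - 1) = m * (o / ‖x‖) := by
          rw [Real.rpow_sub_one (by positivity), ← hm]
          field_simp
        simp only [add_apply, smul_apply,
          ContinuousLinearMap.smulRight_apply, ContinuousLinearMap.id_apply, this,
          innerSL_apply_apply, smul_eq_mul, smul_add, smul_smul]
        congr 2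
        field_simp
      rw [e, norm_smul, mul_pow, Real.norm_of_nonneg hm0.le, norm_add_sq_real, hu, norm_smul,
        real_inner_smul_right, real_inner_comm, mul_pow, Real.norm_eq_abs, sq_abs]
      field_simp
      ring
  refine .of_hasFDerivAt h3 fun u v hu hv => ?_
  obtain ⟨s, hs0, hs1, hs⟩ := hnorm u hu
  obtain ⟨t, ht0, ht1, ht⟩ := hnorm v hv
  refine abs_le_of_sq_le_sq' ?_ (by positivity) |>.2
  rw [mul_pow]
  refine (hs.trans_le ?_).trans_eq (congrArg (K ^ 2 * ·) ht.symm)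
  have hp1 : 2 * p + p ^ 2 ≤ 0 := by nlinarith
  have hp2 : 1 + (2 * p + p ^ 2) = (1 / K) ^ 2 := by rw [hp]; ring
  have a1 : 1 + (2 * p + p ^ 2) * s ≤ 1 := by nlinarith
  have a2 : (1 / K) ^ 2 ≤ 1 + (2 * p + p ^ 2) * t := by nlinarith
  have a3 : 1 ≤ K ^ 2 * (1 + (2 * p + p ^ 2) * t) := by
    calc (1 : ℝ) = K ^ 2 * (1 / K) ^ 2 := by field_simp
      _ ≤ _ := by gcongr
  calc m ^ 2 * (1 + (2 * p + p ^ 2) * s) ≤ m ^ 2 * 1 := by gcongr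
    _ ≤ m ^ 2 * (K ^ 2 * (1 + (2 * p + p ^ 2) * t)) := by gcongr
    _ = _ := by ring

end clampStretch

/-! ### Simultaneous stretching in disjoint disks. -/

/-- Finitely many disjoint disks `closedBall (a k) (o k)` with concentric disks of radii
`i k ≤ o k`. -/
structure IsDiskFamily {ι : Type*} (s : Finset ι) (a : ι → ℂ) (i o : ι → ℝ) : Prop where
  pos : ∀ k ∈ s, 0 < i k
  le : ∀ k ∈ s, i k ≤ o k
  disjoint : (s : Set ι).PairwiseDisjoint fun k => Metric.closedBall (a k) (o k)

/-- The map which performs `clampStretch` in every disk of a family and is the identity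
elsewhere. -/
noncomputable def multiStretch {ι : Type*} (s : Finset ι) (a : ι → ℂ) (i o : ι → ℝ) (p : ℝ)
    (z : ℂ) : ℂ :=
  z + ∑ k ∈ s, (clampStretch p (i k) (o k) (z - a k) - (z - a k))

namespace IsDiskFamily

variable {ι : Type*} {s : Finset ι} {a : ι → ℂ} {i o : ι → ℝ} {p p' : ℝ}

theorem multiStretch_of_mem (h : IsDiskFamily s a i o) {k : ι} (hk : k ∈ s) {z : ℂ}
    (hz : z ∈ Metric.closedBall (a k) (o k)) :
    multiStretch s a i o p z = a k + clampStretch p (i k) (o k) (z - a k) := by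
  rw [multiStretch, Finset.sum_eq_single_of_mem k hk]
  · ring
  · intro l hl hlk
    have hzl : z ∉ Metric.closedBall (a l) (o l) := fun hzl =>
      Set.disjoint_left.1 (h.disjoint hl hk hlk) hzl hz
    rw [Metric.mem_closedBall, dist_eq_norm, not_le] at hzl
    rw [clampStretch_of_ge (h.pos l hl) (h.le l hl) hzl.le, sub_self]

theorem multiStretch_of_notMem (h : IsDiskFamily s a i o) {z : ℂ}
    (hz : ∀ k ∈ s, z ∉ Metric.closedBall (a k) (o k)) : multiStretch s a i o p z = z := by
  rw [multiStretch, Finset.sum_eq_zero, add_zero]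
  intro k hk
  have hzk := hz k hk
  rw [Metric.mem_closedBall, dist_eq_norm, not_le] at hzk
  rw [clampStretch_of_ge (h.pos k hk) (h.le k hk) hzk.le, sub_self]

theorem multiStretch_mem (h : IsDiskFamily s a i o) (hp : 0 < 1 + p) {k : ι} (hk : k ∈ s) {z : ℂ}
    (hz : z ∈ Metric.closedBall (a k) (o k)) :
    multiStretch s a i o p z ∈ Metric.closedBall (a k) (o k) := by
  rw [h.multiStretch_of_mem hk hz, Metric.mem_closedBall, dist_eq_norm, add_sub_cancel_left]
  rw [Metric.mem_closedBall, dist_eq_norm] at hz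
  exact norm_clampStretch_le (h.pos k hk) (h.le k hk) hp hz

theorem image (h : IsDiskFamily s a i o) (hp : 0 < 1 + p) :
    IsDiskFamily s a (fun k => o k * (i k / o k) ^ (1 + p)) o where
  pos k hk := by
    have := h.pos k hk
    have := this.trans_le (h.le k hk)
    positivity
  le k hk := by
    have h1 := h.pos k hk
    have h2 := h1.trans_le (h.le k hk)
    exact mul_le_of_le_one_right h2.le
      (Real.rpow_le_one (by positivity) ((div_le_one h2).2 (h.le k hk)) hp.le)
  disjoint := h.disjoint

theorem multiStretch_multiStretch (h : IsDiskFamily s a i o) (hp : 0 < 1 + p)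
    (hpp : (1 + p) * (1 + p') = 1) (z : ℂ) :
    multiStretch s a (fun k => o k * (i k / o k) ^ (1 + p)) o p'
      (multiStretch s a i o p z) = z := by
  by_cases hz : ∃ k ∈ s, z ∈ Metric.closedBall (a k) (o k)
  · obtain ⟨k, hk, hzk⟩ := hz
    rw [(h.image hp).multiStretch_of_mem hk (h.multiStretch_mem hp hk hzk),
      h.multiStretch_of_mem hk hzk, add_sub_cancel_left,
      clampStretch_clampStretch (h.pos k hk) (h.le k hk) hp hpp, add_sub_cancel]
  · push Not at hz
    rw [h.multiStretch_of_notMem hz, (h.image hp).multiStretch_of_notMem hz]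

theorem continuous_multiStretch (h : IsDiskFamily s a i o) : Continuous (multiStretch s a i o p) :=
  continuous_id.add (continuous_finsetSum _ fun k hk =>
    ((continuous_clampStretch (h.pos k hk) (h.le k hk)).comp (continuous_sub_right _)).sub
      (continuous_sub_right _))

/-- `multiStretch` as a homeomorphism. -/
noncomputable def homeomorph (h : IsDiskFamily s a i o) (hp : 0 < 1 + p) : ℂ ≃ₜ ℂ where
  toFun := multiStretch s a i o p
  invFun := multiStretch s a (fun k => o k * (i k / o k) ^ (1 + p)) o ((1 + p)⁻¹ - 1)
  left_inv z := h.multiStretch_multiStretch hp (by field_simp; ring) z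
  right_inv z := by
    have key := (h.image hp).multiStretch_multiStretch (p := (1 + p)⁻¹ - 1) (p' := p)
      (by simpa using inv_pos.2 hp) (by field_simp; ring) z
    -- Taking the image radii twice, with reciprocal exponents, restores the original inner radii.
    have e : multiStretch s a (fun k => o k * (o k * (i k / o k) ^ (1 + p) / o k) ^
        (1 + ((1 + p)⁻¹ - 1))) o p = multiStretch s a i o p := by
      funext w
      rw [multiStretch, multiStretch]
      congr 1
      refine Finset.sum_congr rfl fun k hk => ?_
      have h1 := h.pos k hk
      have h2 := h1.trans_le (h.le k hk)
      rw [mul_div_cancel_left₀ _ h2.ne', add_sub_cancel, ← Real.rpow_mul (by positivity),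
        mul_inv_cancel₀ hp.ne', Real.rpow_one, mul_div_cancel₀ _ h2.ne']
    rwa [e] at key
  continuous_toFun := h.continuous_multiStretch
  continuous_invFun := (h.image hp).continuous_multiStretch

theorem exists_lipschitzWith_multiStretch (h : IsDiskFamily s a i o) (hp : p ≤ 1) :
    ∃ C, LipschitzWith C (multiStretch s a i o p) := by
  classical
  have key : ∀ t ⊆ s, ∃ C, LipschitzWith C fun z =>
      ∑ k ∈ t, (clampStretch p (i k) (o k) (z - a k) - (z - a k)) := by
    intro t
    induction t using Finset.induction_on with
    | empty => exact fun _ => ⟨0, by simp⟩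
    | insert k t hkt ih =>
      intro ht
      obtain ⟨C, hC⟩ := ih ((Finset.subset_insert k t).trans ht)
      have hk := ht (Finset.mem_insert_self k t)
      obtain ⟨B, hB⟩ := exists_lipschitzWith_clampStretch_sub (h.pos k hk) (h.le k hk) hp
      have hsub : LipschitzWith 1 fun z : ℂ => z - a k :=
        LipschitzWith.of_dist_le_mul fun x y => by simp
      refine ⟨B * 1 + C, ?_⟩
      simp only [Finset.sum_insert hkt]
      exact (hB.comp hsub).add hC
  obtain ⟨C, hC⟩ := key s subset_rfl
  exact ⟨1 + C, LipschitzWith.id.add hC⟩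

/-- Off the null boundary circles the map is locally a similarity, a radial power map or the
identity. -/
theorem ae_hasDistortionAt {K : ℝ} (h : IsDiskFamily s a i o) (hK : 1 ≤ K) :
    ∀ᵐ z, HasDistortionAt K (multiStretch s a i o (1 / K - 1)) z := by
  have hnull : ∀ᵐ z : ℂ, ∀ k ∈ s, z ∉ Metric.sphere (a k) (o k) ∧
      z ∉ Metric.sphere (a k) (i k) := by
    refine (Finset.eventually_all s).2 fun k _ => ?_
    exact (measure_eq_zero_iff_ae_notMem.1 (Measure.addHaar_sphere volume (a k) (o k))).and
      (measure_eq_zero_iff_ae_notMem.1 (Measure.addHaar_sphere volume (a k) (i k)))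
  filter_upwards [hnull] with z hz
  by_cases hzk : ∃ k ∈ s, z ∈ Metric.closedBall (a k) (o k)
  · obtain ⟨k, hk, hzk⟩ := hzk
    obtain ⟨hzo, hzi⟩ := hz k hk
    have hi := h.pos k hk
    have ho := hi.trans_le (h.le k hk)
    have hlt : dist z (a k) < o k := lt_of_le_of_ne hzk hzo
    have hnear : multiStretch s a i o (1 / K - 1) =ᶠ[𝓝 z]
        fun w => a k + clampStretch (1 / K - 1) (i k) (o k) (w - a k) :=
      (Metric.isOpen_ball.mem_nhds (Metric.mem_ball.2 hlt) |> mem_of_superset <|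
        fun w hw => h.multiStretch_of_mem hk (Metric.ball_subset_closedBall hw))
    rcases lt_or_gt_of_ne hzi with hlt' | hgt
    · refine ((hasDistortionAt_id hK z).affine (a k) (a k)
        ((i k / o k) ^ (1 / K - 1))).congr_of_eventuallyEq (hnear.trans ?_)
      filter_upwards [Metric.isOpen_ball.mem_nhds (Metric.mem_ball.2 hlt')] with w hw
      rw [Metric.mem_ball, dist_eq_norm] at hw
      rw [clampStretch_of_le (h.le k hk) hw.le]
    · have hne : z - a k ≠ 0 := by
        rw [← norm_pos_iff, ← dist_eq_norm]
        exact hi.trans hgt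
      have hd := hasDistortionAt_rpow_smul hK ho hne
      have hd' : HasDistortionAt K (fun w : ℂ => a k +
          (‖w - a k‖ / o k) ^ (1 / K - 1) • (w - a k)) z := by
        have hsub : HasFDerivAt (fun w : ℂ => w - a k) (ContinuousLinearMap.id ℝ ℂ) z :=
          (hasFDerivAt_id z).sub_const _
        have hcomp := HasFDerivAt.comp (g := fun w : ℂ => (‖w‖ / o k) ^ (1 / K - 1) • w) z
          hd.1.hasFDerivAt hsub
        exact .of_hasFDerivAt (hcomp.const_add (a k)) hd.2
      refine hd'.congr_of_eventuallyEq (hnear.trans ?_)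
      have hcont : ContinuousAt (fun w : ℂ => ‖w - a k‖) z := by fun_prop
      rw [dist_eq_norm] at hgt
      rw [dist_eq_norm] at hlt
      filter_upwards [hcont.eventually (Ioo_mem_nhds hgt hlt)] with w hw
      rw [clampStretch_of_mem hw.1.le hw.2.le]
  · push Not at hzk
    refine (hasDistortionAt_id hK z).congr_of_eventuallyEq ?_
    have hopen : IsOpen (⋃ k ∈ s, Metric.closedBall (a k) (o k))ᶜ :=
      (s.finite_toSet.isClosed_biUnion fun _ _ => Metric.isClosed_closedBall).isOpen_compl
    filter_upwards [hopen.mem_nhds (by simpa using hzk)] with w hw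
    exact h.multiStretch_of_notMem (by simpa using hw)

end IsDiskFamily

/-! ### The iterated stretching and its limit. -/

/-- A sequence of homeomorphisms which converges geometrically, together with the inverses,
converges to a homeomorphism. -/
theorem exists_homeomorph_tendstoUniformly (Φ : ℕ → ℂ ≃ₜ ℂ) (C : ℝ)
    (h : ∀ n z, dist (Φ n z) (Φ (n + 1) z) ≤ C / 2 / 2 ^ n)
    (h' : ∀ n z, dist ((Φ n).symm z) ((Φ (n + 1)).symm z) ≤ C / 2 / 2 ^ n) :
    ∃ φ : ℂ ≃ₜ ℂ, TendstoUniformly (fun n z => Φ n z) φ atTop := by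
  have key : ∀ F : ℕ → ℂ → ℂ, (∀ n z, dist (F n z) (F (n + 1) z) ≤ C / 2 / 2 ^ n) →
      ∃ f : ℂ → ℂ, TendstoUniformly F f atTop := by
    intro F hF
    choose f hf using fun z => cauchySeq_tendsto_of_complete
      (cauchySeq_of_le_geometric_two (fun n => hF n z))
    refine ⟨f, Metric.tendstoUniformly_iff.2 fun ε hε => ?_⟩
    have ht : Tendsto (fun n : ℕ => C * (1 / 2 : ℝ) ^ n) atTop (𝓝 0) := by
      simpa using (tendsto_pow_atTop_nhds_zero_of_lt_one (r := (1 / 2 : ℝ)) (by norm_num)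
        (by norm_num)).const_mul C
    filter_upwards [ht.eventually (gt_mem_nhds hε)] with n hn z
    rw [dist_comm]
    refine (dist_le_of_le_geometric_two_of_tendsto (fun n => hF n z) (hf z) n).trans_lt ?_
    rwa [one_div, inv_pow, ← div_eq_mul_inv] at hn
  obtain ⟨f, hf⟩ := key (fun n z => Φ n z) h
  obtain ⟨g, hg⟩ := key (fun n z => (Φ n).symm z) h'
  have hfc : Continuous f := hf.continuous (Frequently.of_forall fun n => (Φ n).continuous)
  have hgc : Continuous g := hg.continuous (Frequently.of_forall fun n => (Φ n).symm.continuous)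
  refine ⟨⟨⟨f, g, fun z => ?_, fun z => ?_⟩, hfc, hgc⟩, hf⟩
  · have h1 := hg.tendsto_comp hgc.continuousAt (hf.tendsto_at z)
    simp only [Homeomorph.symm_apply_apply] at h1
    exact tendsto_nhds_unique h1 tendsto_const_nhds
  · have h1 := hf.tendsto_comp hfc.continuousAt (hg.tendsto_at z)
    simp only [Homeomorph.apply_symm_apply] at h1
    exact tendsto_nhds_unique h1 tendsto_const_nhds

namespace DiskTree

variable {τ : DiskTree} {S : ℝ → ℝ} {K : ℝ}

/-- The radius of the packing disk which surrounds the disk realizing a cell. -/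
def outerRadius (τ : DiskTree) (ρ : ℝ → ℝ) : List (ℂ × ℝ) → ℝ
  | [] => 0
  | p :: w => p.2 * ρ (τ.size w)

/-- The radius function of the image of the limit set under the iterated radial stretching. -/
noncomputable def stretchRadius (K : ℝ) (S : ℝ → ℝ) (q : ℝ) : ℝ := S q ^ (1 / K) * q ^ (1 - 1 / K)

namespace IsRadius

theorem stretchRadius (hS : τ.IsRadius S) (hK : 1 ≤ K) : τ.IsRadius (stretchRadius K S) where
  pos q hq := by
    have h1 := hS.pos q hq
    have h2 := hq.1
    rw [DiskTree.stretchRadius]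
    positivity
  root := by
    rw [DiskTree.stretchRadius, hS.root, ← Real.rpow_add τ.q₀_pos, add_sub_cancel, Real.rpow_one]
  mul_le q hq R hR := by
    have hR0 := hR.1
    have hq0 := hq.1
    have h1 := hS.pos q hq
    have h2 : 0 < S (R * q) := hS.pos _ ⟨by positivity,
      (mul_le_of_le_one_left hq0.le hR.2).trans hq.2⟩
    have hK0 : 0 < K := by linarith
    rw [DiskTree.stretchRadius, DiskTree.stretchRadius]
    calc S (R * q) ^ (1 / K) * (R * q) ^ (1 - 1 / K)
        ≤ (R * S q) ^ (1 / K) * (R * q) ^ (1 - 1 / K) := by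
          gcongr
          exact hS.mul_le q hq R hR
      _ = R ^ (1 / K + (1 - 1 / K)) * (S q ^ (1 / K) * q ^ (1 - 1 / K)) := by
          rw [Real.mul_rpow hR0.le h1.le, Real.mul_rpow hR0.le hq0.le, Real.rpow_add hR0]
          ring
      _ = _ := by rw [add_sub_cancel, Real.rpow_one]

theorem isDiskFamily (hS : τ.IsRadius S) (n : ℕ) : IsDiskFamily (τ.gen (n + 1)) (τ.center S)
    (fun w => S (τ.size w)) (τ.outerRadius S) where
  pos w hw := hS.radius_pos hw
  le w hw := by
    obtain ⟨p, hp, v, hv, rfl⟩ := mem_gen_succ.1 hw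
    exact hS.radius_cons_le hv hp
  disjoint := by
    intro w hw w' hw' hne
    obtain ⟨p, hp, v, hv, rfl⟩ := mem_gen_succ.1 hw
    obtain ⟨p', hp', v', hv', rfl⟩ := mem_gen_succ.1 hw'
    by_cases hvv : v = v'
    · subst hvv
      exact hS.outer_disjoint hv hp hp' fun h => hne (by rw [h])
    · exact (hS.inner_disjoint n hv hv' hvv).mono (hS.outer_subset_inner hv hp)
        (hS.outer_subset_inner hv' hp')

theorem one_add_pos (hK : 1 ≤ K) : 0 < 1 + (1 / K - 1) := by
  have : 0 < K := by linarith
  rw [add_sub_cancel]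
  positivity

/-- The homeomorphism which performs the radial stretchings in the packing disks around the cells
of generation `n + 1`. -/
noncomputable def stretch (hS : τ.IsRadius S) (hK : 1 ≤ K) (n : ℕ) : ℂ ≃ₜ ℂ :=
  (hS.isDiskFamily n).homeomorph (one_add_pos hK)

/-- The composition of the radial stretchings up to generation `n`. -/
noncomputable def approx (hS : τ.IsRadius S) (hK : 1 ≤ K) : ℕ → ℂ ≃ₜ ℂ
  | 0 => Homeomorph.refl ℂ
  | n + 1 => (hS.stretch hK n).trans (approx hS hK n)

/-- Points move only within one cell of the previous generation. Inner radii and exponent are left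
free so that the inverse map is covered too. -/
theorem multiStretch_eq_or {i : List (ℂ × ℝ) → ℝ} {p : ℝ} (hS : τ.IsRadius S) {n : ℕ}
    (h : IsDiskFamily (τ.gen (n + 1)) (τ.center S) i (τ.outerRadius S)) (hp : 0 < 1 + p) (z : ℂ) :
    multiStretch (τ.gen (n + 1)) (τ.center S) i (τ.outerRadius S) p z = z ∨
      ∃ v ∈ τ.gen n, z ∈ τ.inner S v ∧
        multiStretch (τ.gen (n + 1)) (τ.center S) i (τ.outerRadius S) p z ∈ τ.inner S v := by
  by_cases hz : ∃ w ∈ τ.gen (n + 1), z ∈ Metric.closedBall (τ.center S w) (τ.outerRadius S w)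
  · obtain ⟨w, hw, hzw⟩ := hz
    have hzw' := h.multiStretch_mem hp hw hzw
    obtain ⟨q, hq, v, hv, rfl⟩ := mem_gen_succ.1 hw
    exact Or.inr ⟨v, hv, hS.outer_subset_inner hv hq hzw, hS.outer_subset_inner hv hq hzw'⟩
  · push Not at hz
    exact Or.inl (h.multiStretch_of_notMem hz)

variable (hS : τ.IsRadius S) (hK : 1 ≤ K)

theorem stretch_eq_or (n : ℕ) (z : ℂ) : hS.stretch hK n z = z ∨
    ∃ v ∈ τ.gen n, z ∈ τ.inner S v ∧ hS.stretch hK n z ∈ τ.inner S v :=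
  hS.multiStretch_eq_or (hS.isDiskFamily n) (one_add_pos hK) z

theorem stretch_symm_eq_or (n : ℕ) (z : ℂ) : (hS.stretch hK n).symm z = z ∨
    ∃ v ∈ τ.gen n, z ∈ τ.inner S v ∧ (hS.stretch hK n).symm z ∈ τ.inner S v :=
  hS.multiStretch_eq_or ((hS.isDiskFamily n).image (one_add_pos hK))
    (by rw [add_sub_cancel]; exact inv_pos.2 (one_add_pos hK)) z

theorem stretch_of_notMem {n : ℕ} {z : ℂ} (hz : z ∉ τ.level S n) : hS.stretch hK n z = z := by
  rcases hS.stretch_eq_or hK n z with h | ⟨v, hv, h, -⟩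
  · exact h
  · exact absurd (mem_biUnion hv h) hz

theorem stretch_mem_inner {n : ℕ} {z : ℂ} {w : List (ℂ × ℝ)} (hw : w ∈ τ.gen n)
    (hz : z ∈ τ.inner S w) : hS.stretch hK n z ∈ τ.inner S w := by
  rcases hS.stretch_eq_or hK n z with h | ⟨v, hv, h, h'⟩
  · rwa [h]
  · by_cases hvw : v = w
    · rwa [← hvw]
    · exact absurd hz (Set.disjoint_left.1 (hS.inner_disjoint n hv hw hvw) h)

theorem stretch_mem_level_iff {n m : ℕ} (hnm : n ≤ m) {z : ℂ} :
    hS.stretch hK m z ∈ τ.level S n ↔ z ∈ τ.level S n := by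
  rcases hS.stretch_eq_or hK m z with h | ⟨v, hv, h, h'⟩
  · rw [h]
  · exact iff_of_true (hS.level_antitone hnm (mem_biUnion hv h'))
      (hS.level_antitone hnm (mem_biUnion hv h))

theorem approx_succ_apply (n : ℕ) (z : ℂ) :
    hS.approx hK (n + 1) z = hS.approx hK n (hS.stretch hK n z) := rfl

theorem stretch_apply_of_mem_inner {n : ℕ} {w : List (ℂ × ℝ)} (hw : w ∈ τ.gen n) {p : ℂ × ℝ}
    (hp : p ∈ τ.pack n) {z : ℂ} (hz : z ∈ τ.inner S (p :: w)) :
    hS.stretch hK n z = τ.center S (p :: w) +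
      (S (τ.size (p :: w)) / (p.2 * S (τ.size w))) ^ (1 / K - 1) • (z - τ.center S (p :: w)) := by
  have h := (hS.isDiskFamily n).multiStretch_of_mem (p := 1 / K - 1)
    (mem_gen_succ.2 ⟨p, hp, w, hw, rfl⟩) (hS.inner_cons_subset hw hp hz)
  rw [inner, Metric.mem_closedBall, dist_eq_norm] at hz
  rw [outerRadius, clampStretch_of_le (hS.radius_cons_le hw hp) hz] at h
  exact h

/-- Up to its own generation every cell undergoes a similarity. Passing to a child multiplies the
ratio by `(S (R * q) / (R * S q)) ^ (1 / K - 1)`, which is what the formula for `stretchRadius`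
reproduces. -/
theorem approx_apply_of_mem_inner {n : ℕ} {w : List (ℂ × ℝ)} (hw : w ∈ τ.gen n) {z : ℂ}
    (hz : z ∈ τ.inner S w) :
    hS.approx hK n z = τ.center (DiskTree.stretchRadius K S) w +
      (DiskTree.stretchRadius K S (τ.size w) / S (τ.size w)) • (z - τ.center S w) := by
  induction n generalizing w z with
  | zero =>
    obtain ⟨c, -, rfl⟩ := mem_gen_zero.1 hw
    have h0 := τ.q₀_pos.ne'
    simp [center, size, hS.root, (hS.stretchRadius hK).root, approx, h0]
  | succ n ih =>
    obtain ⟨p, hp, v, hv, rfl⟩ := mem_gen_succ.1 hw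
    have hzv : z ∈ τ.inner S v := hS.outer_subset_inner hv hp (hS.inner_cons_subset hv hp hz)
    rw [approx_succ_apply, ih hv (hS.stretch_mem_inner hK hv hzv),
      hS.stretch_apply_of_mem_inner hK hv hp hz]
    have hSw := hS.radius_pos hw
    have hSv := hS.radius_pos hv
    have hp0 := (τ.isPacking n).pos p hp
    have hqv := (size_mem hv).1
    have hfac : DiskTree.stretchRadius K S (τ.size v) / S (τ.size v) *
        (S (τ.size (p :: v)) / (p.2 * S (τ.size v))) ^ (1 / K - 1) =
        DiskTree.stretchRadius K S (τ.size (p :: v)) / S (τ.size (p :: v)) := by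
      have e : ∀ q, 0 < S q → DiskTree.stretchRadius K S q / S q =
          S q ^ (1 / K - 1) * q ^ (1 - 1 / K) := fun q hq => by
        rw [DiskTree.stretchRadius, Real.rpow_sub hq, Real.rpow_one]
        ring
      rw [e _ hSv, e _ hSw, Real.div_rpow hSw.le (by positivity), Real.mul_rpow hp0.le hSv.le,
        size, Real.mul_rpow hp0.le hqv.le, show 1 - 1 / K = -(1 / K - 1) by ring,
        Real.rpow_neg hp0.le]
      have h1 : S (τ.size v) ^ (1 / K - 1) ≠ 0 := by positivity
      have h2 : p.2 ^ (1 / K - 1) ≠ 0 := by positivity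
      field_simp
    have hTv : ((DiskTree.stretchRadius K S (τ.size v) / S (τ.size v) : ℝ) : ℂ) *
        (S (τ.size v) : ℂ) = (DiskTree.stretchRadius K S (τ.size v) : ℂ) := by
      rw [← Complex.ofReal_mul, div_mul_cancel₀ _ hSv.ne']
    rw [← hfac]
    simp only [center, Complex.real_smul, Complex.ofReal_mul]
    linear_combination p.1 * hTv

theorem approx_mem_inner {n : ℕ} {w : List (ℂ × ℝ)} (hw : w ∈ τ.gen n) {z : ℂ}
    (hz : z ∈ τ.inner S w) : hS.approx hK n z ∈ τ.inner (DiskTree.stretchRadius K S) w := by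
  have h1 := hS.radius_pos hw
  have h2 := (hS.stretchRadius hK).radius_pos hw
  rw [hS.approx_apply_of_mem_inner hK hw hz, inner, Metric.mem_closedBall, dist_eq_norm,
    add_sub_cancel_left, norm_smul, Real.norm_of_nonneg (by positivity)]
  rw [inner, Metric.mem_closedBall, dist_eq_norm] at hz
  calc _ ≤ DiskTree.stretchRadius K S (τ.size w) / S (τ.size w) * S (τ.size w) := by gcongr
    _ = _ := by field_simp

theorem exists_approx_eq {n : ℕ} {w : List (ℂ × ℝ)} (hw : w ∈ τ.gen n) {y : ℂ}
    (hy : y ∈ τ.inner (DiskTree.stretchRadius K S) w) :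
    ∃ z ∈ τ.inner S w, hS.approx hK n z = y := by
  have h1 := hS.radius_pos hw
  have h2 := (hS.stretchRadius hK).radius_pos hw
  have hz : τ.center S w + (S (τ.size w) / DiskTree.stretchRadius K S (τ.size w)) •
      (y - τ.center (DiskTree.stretchRadius K S) w) ∈ τ.inner S w := by
    rw [inner, Metric.mem_closedBall, dist_eq_norm, add_sub_cancel_left, norm_smul,
      Real.norm_of_nonneg (by positivity)]
    rw [inner, Metric.mem_closedBall, dist_eq_norm] at hy
    calc _ ≤ S (τ.size w) / DiskTree.stretchRadius K S (τ.size w) *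
          DiskTree.stretchRadius K S (τ.size w) := by gcongr
      _ = _ := by field_simp
  refine ⟨_, hz, ?_⟩
  rw [hS.approx_apply_of_mem_inner hK hw hz, add_sub_cancel_left, smul_smul,
    div_mul_div_cancel₀ h1.ne', div_self h2.ne', one_smul, add_sub_cancel]

/-- Stretchings of later generations preserve the level `n`, so only `m = n` matters, where cells
map onto cells. -/
theorem approx_mem_level_iff {n m : ℕ} (hnm : n ≤ m) {z : ℂ} :
    hS.approx hK m z ∈ τ.level (DiskTree.stretchRadius K S) n ↔ z ∈ τ.level S n := by
  induction m, hnm using Nat.le_induction generalizing z with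
  | base =>
    constructor
    · intro h
      obtain ⟨w, hw, hzw⟩ := mem_iUnion₂.1 h
      obtain ⟨x, hx, hxz⟩ := hS.exists_approx_eq hK hw hzw
      rw [← (hS.approx hK n).injective hxz]
      exact mem_biUnion hw hx
    · intro h
      obtain ⟨w, hw, hzw⟩ := mem_iUnion₂.1 h
      exact mem_biUnion hw (hS.approx_mem_inner hK hw hzw)
  | succ m hm ih => rw [approx_succ_apply, ih, hS.stretch_mem_level_iff hK hm]

theorem approx_of_notMem {n m : ℕ} (hnm : n ≤ m) {z : ℂ} (hz : z ∉ τ.level S n) :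
    hS.approx hK m z = hS.approx hK n z := by
  induction m, hnm using Nat.le_induction with
  | base => rfl
  | succ m hm ih =>
    rw [approx_succ_apply, hS.stretch_of_notMem hK fun h => hz (hS.level_antitone hm h), ih]

theorem dist_le_of_mem_inner (hS : τ.IsRadius S) {n : ℕ} {w : List (ℂ × ℝ)}
    (hw : w ∈ τ.gen n) {x y : ℂ}
    (hx : x ∈ τ.inner S w) (hy : y ∈ τ.inner S w) : dist x y ≤ 4 * τ.q₀ / 2 / 2 ^ n := by
  have h1 := Metric.mem_closedBall.1 hx
  have h2 := Metric.mem_closedBall'.1 hy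
  have h3 := hS.radius_le hw
  have h4 : 4 * τ.q₀ / 2 / 2 ^ n = 2 * (τ.q₀ * (1 / 2) ^ n) := by
    rw [one_div, inv_pow]; ring
  linarith [dist_triangle x (τ.center S w) y]

/-- Consecutive maps differ only within a common image cell, and their inverses within a common
source cell; both have diameters decaying like `2 ^ (-n)`. -/
theorem exists_limit : ∃ φ : ℂ ≃ₜ ℂ, TendstoUniformly (fun n z => hS.approx hK n z) φ atTop := by
  have hpos : ∀ n : ℕ, 0 ≤ 4 * τ.q₀ / 2 / 2 ^ n := fun n => by
    have := τ.q₀_pos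
    positivity
  refine exists_homeomorph_tendstoUniformly (hS.approx hK) (4 * τ.q₀) (fun n z => ?_) fun n z => ?_
  · rw [approx_succ_apply]
    rcases hS.stretch_eq_or hK n z with h | ⟨v, hv, h, h'⟩
    · rw [h, dist_self]
      exact hpos n
    · exact (hS.stretchRadius hK).dist_le_of_mem_inner hv (hS.approx_mem_inner hK hv h)
        (hS.approx_mem_inner hK hv h')
  · change dist _ ((hS.stretch hK n).symm ((hS.approx hK n).symm z)) ≤ _
    rcases hS.stretch_symm_eq_or hK n ((hS.approx hK n).symm z) with h | ⟨v, hv, h, h'⟩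
    · rw [h, dist_self]
      exact hpos n
    · exact hS.dist_le_of_mem_inner hv h h'

theorem exists_lipschitzWith_approx (n : ℕ) : ∃ C, LipschitzWith C (hS.approx hK n) := by
  induction n with
  | zero => exact ⟨1, LipschitzWith.id⟩
  | succ n ih =>
    obtain ⟨C, hC⟩ := ih
    have hK0 : 0 < K := by linarith
    obtain ⟨B, hB⟩ := (hS.isDiskFamily n).exists_lipschitzWith_multiStretch (p := 1 / K - 1)
      (by linarith [(div_le_one hK0).2 hK])
    exact ⟨C * B, hC.comp hB⟩

/-- Distortions do not accumulate: on the level `n` the outer map is a similarity and only the new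
stretching distorts, while off it the new stretching is the identity. -/
theorem ae_hasDistortionAt_approx (n : ℕ) : ∀ᵐ z, HasDistortionAt K (hS.approx hK n) z := by
  induction n with
  | zero => exact Eventually.of_forall fun z => hasDistortionAt_id hK z
  | succ n ih =>
    have hnull : ∀ᵐ z : ℂ, ∀ w ∈ τ.gen n, z ∉ Metric.sphere (τ.center S w) (S (τ.size w)) :=
      (Finset.eventually_all _).2 fun w _ =>
        measure_eq_zero_iff_ae_notMem.1 (Measure.addHaar_sphere volume _ _)
    filter_upwards [ih, (hS.isDiskFamily n).ae_hasDistortionAt hK, hnull] with z h1 h2 h3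
    by_cases hz : z ∈ τ.level S n
    · obtain ⟨w, hw, hzw⟩ := mem_iUnion₂.1 hz
      refine (h2.affine (τ.center S w) (τ.center (DiskTree.stretchRadius K S) w)
        (DiskTree.stretchRadius K S (τ.size w) / S (τ.size w))).congr_of_eventuallyEq ?_
      have hball : z ∈ Metric.ball (τ.center S w) (S (τ.size w)) :=
        lt_of_le_of_ne hzw (h3 w hw)
      filter_upwards [Metric.isOpen_ball.mem_nhds hball] with x hx
      rw [approx_succ_apply, hS.approx_apply_of_mem_inner hK hw
        (hS.stretch_mem_inner hK hw (Metric.ball_subset_closedBall hx))]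
      rfl
    · refine h1.congr_of_eventuallyEq ?_
      filter_upwards [(isCompact_level n).isClosed.isOpen_compl.mem_nhds hz] with x hx
      rw [approx_succ_apply, hS.stretch_of_notMem hK hx]

/-- The iterated radial stretching associated with a tree of disks: it is quasiconformal and maps
the limit set for one radius function to that for the other. -/
theorem exists_isQuasiconformal (hS : τ.IsRadius S) (hK : 1 ≤ K)
    (hsmall : ∀ η : ℝ, 0 < η → ∃ δ > 0, ∀ q ∈ Ioc 0 τ.q₀, q < δ → S q ≤ η * q) :
    ∃ φ : ℂ ≃ₜ ℂ, IsQuasiconformal K φ ∧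
      φ '' τ.limitSet S = τ.limitSet (DiskTree.stretchRadius K S) := by
  obtain ⟨φ, hφ⟩ := hS.exists_limit hK
  have hφn : ∀ n, ∀ z ∉ τ.level S n, φ z = hS.approx hK n z := fun n z hz =>
    tendsto_nhds_unique (hφ.tendsto_at z) (tendsto_atTop_of_eventually_const (i₀ := n)
      fun m hm => hS.approx_of_notMem hK hm hz)
  have hlev : ∀ n z, φ z ∈ τ.level (DiskTree.stretchRadius K S) n ↔ z ∈ τ.level S n := by
    intro n z
    constructor
    · intro h
      by_contra hz
      rw [hφn n z hz] at h
      exact hz ((hS.approx_mem_level_iff hK le_rfl).1 h)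
    · intro h
      exact (isCompact_level n).isClosed.mem_of_tendsto (hφ.tendsto_at z)
        ((eventually_ge_atTop n).mono fun m hm => (hS.approx_mem_level_iff hK hm).2 h)
  have hnear : ∀ n, ∀ z ∉ τ.level S n, φ =ᶠ[𝓝 z] hS.approx hK n := by
    intro n z hz
    filter_upwards [(isCompact_level n).isClosed.isOpen_compl.mem_nhds hz] with x hx
    exact hφn n x hx
  -- Once the sizes are small, the area is at most `π η² ∑ q²`, and `∑ q²` is bounded over all
  -- generations.
  have hvol : Tendsto (fun n => volume (τ.level S n)) atTop (𝓝 0) := by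
    rw [ENNReal.tendsto_nhds_zero]
    intro ε hε
    set M : ℝ := Real.pi * (τ.base.card * τ.q₀ ^ 2) with hM
    have hM0 : 0 ≤ M := by positivity
    obtain ⟨η, hη, hηε⟩ : ∃ η : ℝ, 0 < η ∧ ENNReal.ofReal (η ^ 2 * M) ≤ ε := by
      have hc : Tendsto (fun η : ℝ => ENNReal.ofReal (η ^ 2 * M)) (𝓝[>] 0) (𝓝 0) := by
        have : Continuous fun η : ℝ => ENNReal.ofReal (η ^ 2 * M) :=
          ENNReal.continuous_ofReal.comp (by fun_prop)
        have := this.tendsto 0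
        simp only [ne_eq, OfNat.ofNat_ne_zero, not_false_eq_true, zero_pow, zero_mul,
          ENNReal.ofReal_zero] at this
        exact this.mono_left nhdsWithin_le_nhds
      obtain ⟨η, h1, h2⟩ := ((hc.eventually (ge_mem_nhds hε)).and self_mem_nhdsWithin).exists
      exact ⟨η, h2, h1⟩
    obtain ⟨δ, hδ, hδS⟩ := hsmall η hη
    have ht : Tendsto (fun n : ℕ => τ.q₀ * (1 / 2 : ℝ) ^ n) atTop (𝓝 0) := by
      simpa using (tendsto_pow_atTop_nhds_zero_of_lt_one (r := (1 / 2 : ℝ)) (by norm_num)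
        (by norm_num)).const_mul τ.q₀
    filter_upwards [ht.eventually (gt_mem_nhds hδ)] with n hn
    refine le_trans ?_ hηε
    calc volume (τ.level S n) ≤ ∑ w ∈ τ.gen n, volume (τ.inner S w) :=
          measure_biUnion_finset_le _ _
      _ = ∑ w ∈ τ.gen n, ENNReal.ofReal (Real.pi * S (τ.size w) ^ 2) := by
          refine Finset.sum_congr rfl fun w hw => ?_
          rw [inner, ← ofReal_measureReal measure_closedBall_lt_top.ne,
            Complex.volume_real_closedBall _ (hS.radius_pos hw).le]
      _ = ENNReal.ofReal (∑ w ∈ τ.gen n, Real.pi * S (τ.size w) ^ 2) :=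
          (ENNReal.ofReal_sum_of_nonneg fun _ _ => by positivity).symm
      _ ≤ _ := by
          refine ENNReal.ofReal_le_ofReal ?_
          calc ∑ w ∈ τ.gen n, Real.pi * S (τ.size w) ^ 2
              ≤ ∑ w ∈ τ.gen n, η ^ 2 * Real.pi * τ.size w ^ 2 := by
                refine Finset.sum_le_sum fun w hw => ?_
                have h1 := hδS _ (size_mem' hw) ((size_mem hw).2.trans_lt hn)
                have h2 := (hS.radius_pos hw).le
                calc Real.pi * S (τ.size w) ^ 2 ≤ Real.pi * (η * τ.size w) ^ 2 := by gcongr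
                  _ = _ := by ring
            _ ≤ η ^ 2 * Real.pi * (τ.base.card * τ.q₀ ^ 2) := by
                rw [← Finset.mul_sum]
                exact mul_le_mul_of_nonneg_left (sum_size_sq_le n) (by positivity)
            _ = _ := by rw [hM]; ring
  refine ⟨φ, ?_, ?_⟩
  · obtain ⟨R, hR⟩ := (isCompact_level (τ := τ) (ρ := S) 0).isBounded.subset_closedBall 0
    refine isQuasiconformal_of_tendsto φ (hS.approx hK) (hS.exists_lipschitzWith_approx hK) hφ
      (R := R) (fun z hz => ?_) (hS.ae_hasDistortionAt_approx hK) ?_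
      (A := fun n => τ.level S n) (fun n => (isCompact_level n).measurableSet) hvol
      (fun n z hz => (hnear n z hz).fderiv_eq)
      (B := τ.level (DiskTree.stretchRadius K S) 0) (isCompact_level 0).measure_lt_top.ne ?_ ?_
    · refine hφn 0 z fun h => ?_
      exact absurd (mem_closedBall_zero_iff.1 (hR h)) (not_le.2 hz)
    · have hnull : ∀ᵐ z : ℂ, z ∉ τ.limitSet S := by
        refine measure_eq_zero_iff_ae_notMem.1 (le_antisymm ?_ zero_le)
        exact ge_of_tendsto' hvol fun n => measure_mono (iInter_subset _ n)
      filter_upwards [hnull, ae_all_iff.2 (hS.ae_hasDistortionAt_approx hK)] with z hz hd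
      obtain ⟨n, hn⟩ := not_forall.1 (mt mem_iInter.2 hz)
      exact (hd n).congr_of_eventuallyEq (hnear n z hn)
    · rintro n _ ⟨z, hz, rfl⟩
      exact (hS.stretchRadius hK).level_antitone (Nat.zero_le n)
        ((hS.approx_mem_level_iff hK le_rfl).2 hz)
    · rintro n _ ⟨z, hz, rfl⟩
      exact (hS.stretchRadius hK).level_antitone (Nat.zero_le n) ((hlev n z).2 hz)
  · ext y
    obtain ⟨z, rfl⟩ := φ.surjective y
    rw [φ.injective.mem_set_image, limitSet, limitSet, mem_iInter, mem_iInter]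
    exact forall_congr' fun n => (hlev n z).symm

end IsRadius
end DiskTree

/-! ### Choice of the tree and of the radius function. -/

theorem exists_forall_isPacking : ∃ P : ℕ → Finset (ℂ × ℝ), (∀ n, IsPacking (P n)) ∧
    ∀ n, 1 / 2 ≤ ∏ k ∈ Finset.range n, ∑ p ∈ P k, p.2 ^ 2 := by
  choose P hP hsum using fun n : ℕ => exists_isPacking (η := (1 / 2) ^ (n + 2)) (by positivity)
  refine ⟨P, hP, fun n => ?_⟩
  -- The extra term leaves room for the loss `2 ^ (-(n + 2))` of the next packing; at `n = 0` both
  -- sides equal 1.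
  have key : 1 / 2 + (1 / 2) ^ (n + 1) ≤ ∏ k ∈ Finset.range n, ∑ p ∈ P k, p.2 ^ 2 := by
    induction n with
    | zero => norm_num
    | succ n ih =>
      rw [Finset.prod_range_succ]
      have h1 := hsum n
      have h2 : (1 / 2 : ℝ) ^ n ≤ 1 := pow_le_one₀ (by norm_num) (by norm_num)
      have h3 : (0 : ℝ) < (1 / 2) ^ n := by positivity
      simp only [pow_succ] at ih h1 ⊢
      refine le_trans ?_ (mul_le_mul ih h1 (by linarith) (le_trans (by positivity) ih))
      nlinarith
  exact le_trans (by linarith [pow_pos (one_half_pos (α := ℝ)) (n + 1)]) key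

theorem exists_diskTree {q₀ : ℝ} (hq₀ : 0 < q₀) (M : ℕ) :
    ∃ τ : DiskTree, τ.q₀ = q₀ ∧ τ.base.card = M := by
  classical
  obtain ⟨P, hP, hprod⟩ := exists_forall_isPacking
  have hinj : Function.Injective fun j : ℕ => (3 * j : ℂ) := fun i j h => by
    simpa using h
  refine ⟨⟨q₀, hq₀, (Finset.range M).image fun j : ℕ => (3 * j : ℂ), ?_, P, hP, hprod⟩, rfl, ?_⟩
  · intro x hx y hy hne
    obtain ⟨i, -, rfl⟩ := Finset.mem_image.1 (Finset.mem_coe.1 hx)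
    obtain ⟨j, -, rfl⟩ := Finset.mem_image.1 (Finset.mem_coe.1 hy)
    refine Metric.closedBall_disjoint_closedBall ?_
    have hij : (i : ℤ) ≠ j := fun h => hne (by rw [Int.ofNat_inj.1 h])
    have h1 : (1 : ℝ) ≤ |(((i : ℤ) - j : ℤ) : ℝ)| := by
      rw [← Int.cast_abs]
      exact_mod_cast Int.one_le_abs (sub_ne_zero.2 hij)
    have h2 : dist (3 * i : ℂ) (3 * j : ℂ) = 3 * |(((i : ℤ) - j : ℤ) : ℝ)| := by
      rw [dist_eq_norm, ← mul_sub, norm_mul, ← Real.norm_eq_abs, ← Complex.norm_real]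
      norm_num
    rw [h2]
    linarith
  · rw [Finset.card_image_of_injective _ hinj, Finset.card_range]

/-- The smallest solution of `h x = y`. -/
theorem IsGauge.exists_least {h : ℝ → ℝ} (hh : IsGauge h) (h0 : h 0 = 0) {r y : ℝ} (hr : 0 ≤ r)
    (hy : y ∈ Icc 0 (h r)) :
    ∃ x ∈ Icc 0 r, h x = y ∧ ∀ x' ∈ Icc 0 r, y ≤ h x' → x ≤ x' := by
  have hc : ∀ s, ContinuousOn h (Icc 0 s) := fun s => hh.continuousOn.mono Icc_subset_Ici_self
  have hivt : ∀ s, 0 ≤ s → y ≤ h s → ∃ x ∈ Icc 0 s, h x = y := fun s hs hys =>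
    intermediate_value_Icc hs (hc s) ⟨by rw [h0]; exact hy.1, hys⟩
  have hcomp : IsCompact (Icc 0 r ∩ h ⁻¹' {y}) :=
    isCompact_Icc.of_isClosed_subset
      ((hc r).preimage_isClosed_of_isClosed isClosed_Icc isClosed_singleton) inter_subset_left
  obtain ⟨x₁, hx₁, hyx₁⟩ := hivt r hr hy.2
  obtain ⟨x, hx⟩ := hcomp.exists_isLeast ⟨x₁, hx₁, hyx₁⟩
  refine ⟨x, hx.1.1, hx.1.2, fun x' hx' hyx' => ?_⟩
  obtain ⟨x₂, hx₂, hyx₂⟩ := hivt x' hx'.1 hyx'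
  exact (hx.2 ⟨⟨hx₂.1, hx₂.2.trans hx'.2⟩, hyx₂⟩).trans hx₂.2

theorem mul_sq_le_of_antitoneOn {h : ℝ → ℝ} {x₀ r s : ℝ}
    (ha : AntitoneOn (fun r => h r / r ^ 2) (Ioo 0 x₀)) (hr : 0 < r) (hrs : r ≤ s) (hs : s < x₀) :
    h s * r ^ 2 ≤ h r * s ^ 2 := by
  have hs0 := hr.trans_le hrs
  have := ha ⟨hr, hrs.trans_lt hs⟩ ⟨hs0, hs⟩ hrs
  rwa [div_le_div_iff₀ (by positivity) (by positivity)] at this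

/-- The radius function which turns sizes of cells into radii of disks, such that the gauge of the
radius is proportional to the square of the size. -/
theorem IsGauge.exists_radius {h : ℝ → ℝ} (hh : IsGauge h) (h0 : h 0 = 0) {x₀ r₀ : ℝ}
    (ha : AntitoneOn (fun r => h r / r ^ 2) (Ioo 0 x₀)) (hr₀ : r₀ ∈ Ioo 0 x₀) :
    ∃ q₀ ∈ Ioc 0 r₀, h q₀ = h r₀ ∧ ∃ S : ℝ → ℝ, S q₀ = q₀ ∧
      (∀ q ∈ Ioc 0 q₀, 0 < S q ∧ S q ≤ q ∧ h (S q) = h q₀ / q₀ ^ 2 * q ^ 2) ∧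
      ∀ q ∈ Ioc 0 q₀, ∀ R ∈ Ioc (0 : ℝ) 1, S (R * q) ≤ R * S q := by
  have hpos := hh.pos r₀ hr₀.1
  choose! m hm hhm hmin using fun y (hy : y ∈ Icc 0 (h r₀)) =>
    hh.exists_least h0 hr₀.1.le hy
  have hmpos : ∀ y ∈ Icc 0 (h r₀), 0 < y → 0 < m y := by
    intro y hy hy0
    refine lt_of_le_of_ne (hm y hy).1 fun h' => ?_
    have := hhm y hy
    rw [← h', h0] at this
    exact hy0.ne this
  have hr₀mem : h r₀ ∈ Icc 0 (h r₀) := ⟨hpos.le, le_rfl⟩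
  set q₀ := m (h r₀) with hq₀
  have hq₀pos : 0 < q₀ := hmpos _ hr₀mem hpos
  have hq₀le : q₀ ≤ r₀ := (hm _ hr₀mem).2
  have hhq₀ : h q₀ = h r₀ := hhm _ hr₀mem
  have hmem : ∀ q ∈ Ioc 0 q₀, h q₀ / q₀ ^ 2 * q ^ 2 ∈ Icc 0 (h r₀) := by
    intro q hq
    rw [hhq₀]
    refine ⟨by positivity, ?_⟩
    rw [div_mul_eq_mul_div, div_le_iff₀ (by positivity)]
    have := hq.1
    have := hq.2
    gcongr
  have hypos : ∀ q ∈ Ioc 0 q₀, 0 < h q₀ / q₀ ^ 2 * q ^ 2 := fun q hq => by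
    have := hq.1
    rw [hhq₀]
    positivity
  have hle : ∀ q ∈ Ioc 0 q₀, m (h q₀ / q₀ ^ 2 * q ^ 2) ≤ q := by
    intro q hq
    refine hmin _ (hmem q hq) q ⟨hq.1.le, hq.2.trans hq₀le⟩ ?_
    rw [div_mul_eq_mul_div, div_le_iff₀ (by positivity)]
    exact mul_sq_le_of_antitoneOn ha hq.1 hq.2 (hq₀le.trans_lt hr₀.2)
  refine ⟨q₀, ⟨hq₀pos, hq₀le⟩, hhq₀, fun q => m (h q₀ / q₀ ^ 2 * q ^ 2), ?_, fun q hq =>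
    ⟨hmpos _ (hmem q hq) (hypos q hq), hle q hq, hhm _ (hmem q hq)⟩, fun q hq R hR => ?_⟩
  · change m (h q₀ / q₀ ^ 2 * q₀ ^ 2) = m (h r₀)
    rw [div_mul_cancel₀ _ (by positivity), hhq₀]
  · have hR0 := hR.1
    have hq0 := hq.1
    have hRq : R * q ∈ Ioc 0 q₀ :=
      ⟨by positivity, (mul_le_of_le_one_left hq0.le hR.2).trans hq.2⟩
    have hS := hmpos _ (hmem q hq) (hypos q hq)
    have hRS : R * m (h q₀ / q₀ ^ 2 * q ^ 2) ≤ m (h q₀ / q₀ ^ 2 * q ^ 2) :=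
      mul_le_of_le_one_left hS.le hR.2
    -- By minimality of the solution it suffices that `h` at `R * S q` is at least `c * (R * q) ^
    -- 2`, which follows from the monotonicity of `h r / r ^ 2`.
    refine hmin _ (hmem _ hRq) _ ⟨by positivity, hRS.trans (hm _ (hmem q hq)).2⟩ ?_
    have h1 := mul_sq_le_of_antitoneOn ha (by positivity) hRS
      ((hm _ (hmem q hq)).2.trans_lt hr₀.2)
    rw [hhm _ (hmem q hq)] at h1
    rw [mul_pow] at h1
    have h2 : 0 < m (h q₀ / q₀ ^ 2 * q ^ 2) ^ 2 := by positivity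
    refine le_of_mul_le_mul_right ?_ h2
    calc _ = h q₀ / q₀ ^ 2 * q ^ 2 * (R ^ 2 * m (h q₀ / q₀ ^ 2 * q ^ 2) ^ 2) := by ring
      _ ≤ _ := h1

/-- Both regimes of the mass estimate follow from the bound at the radius of the cell itself: for `ρ
q ≤ r` because `g` increases, for `r < ρ q` because `g r / r ^ 2` decreases. -/
theorem DiskTree.IsRadius.le_gaugeHausdorff {τ : DiskTree} {ρ : ℝ → ℝ} (hρ : τ.IsRadius ρ)
    {g : ℝ → ℝ} {C x₀ : ℝ} (hC : 0 < C) (hx₀ : τ.q₀ < x₀) (gpos : ∀ r ∈ Ioo 0 x₀, 0 < g r)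
    (gmono : MonotoneOn g (Ioo 0 x₀)) (ganti : AntitoneOn (fun r => g r / r ^ 2) (Ioo 0 x₀))
    (hq : ∀ q ∈ Ioc 0 τ.q₀, q ^ 2 ≤ C * g (ρ q)) :
    ENNReal.ofReal (τ.base.card * τ.q₀ ^ 2 / (18 * C)) ≤ gaugeHausdorff g (τ.limitSet ρ) := by
  refine le_trans (hρ.le_hausdorffPre hC le_rfl (fun r hr hr2 => ?_) (fun r hr hr2 q hq' hqr => ?_)
    fun r hr hr2 q hq' hqr => ?_) (le_iSup₂ (f := fun δ (_ : 0 < δ) =>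
      hausdorffPre g δ (τ.limitSet ρ)) τ.q₀ τ.q₀_pos)
  · exact (gpos _ ⟨by linarith, by linarith⟩).le
  · refine (hq q hq').trans ?_
    gcongr
    exact gmono ⟨hρ.pos q hq', by linarith⟩ ⟨by linarith, by linarith⟩ (by linarith)
  · have h0 := hρ.pos q hq'
    have hlt : ρ q < x₀ := ((hρ.le_self hq').trans hq'.2).trans_lt hx₀
    have h1 := mul_sq_le_of_antitoneOn ganti hr hqr.le hlt
    have h2 : g r ≤ g (2 * r) := gmono ⟨hr, by linarith⟩ ⟨by linarith, by linarith⟩ (by linarith)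
    calc q ^ 2 * r ^ 2 ≤ C * g (ρ q) * r ^ 2 := by gcongr; exact hq q hq'
      _ = C * (g (ρ q) * r ^ 2) := by ring
      _ ≤ C * (g r * ρ q ^ 2) := by gcongr
      _ ≤ C * (g (2 * r) * ρ q ^ 2) := by gcongr
      _ = _ := by ring

/-- The distortion theorem for general pairs of gauges. -/
theorem exists_compact_quasiconformal {K : ℝ} (hK : 1 ≤ K) {h g : ℝ → ℝ} {x₀ : ℝ} (hx₀ : 0 < x₀)
    (hh : IsGauge h) (h0 : h 0 = 0) (hanti : AntitoneOn (fun r => h r / r ^ 2) (Ioo 0 x₀))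
    (hinf : Tendsto (fun r => h r / r ^ 2) (𝓝[>] 0) atTop)
    (gpos : ∀ r ∈ Ioo 0 x₀, 0 < g r) (gmono : MonotoneOn g (Ioo 0 x₀))
    (ganti : AntitoneOn (fun r => g r / r ^ 2) (Ioo 0 x₀))
    (hcomp : ∀ c : ℝ, 0 < c → ∃ C : ℝ, 0 < C ∧ ∀ s q : ℝ, 0 < s → s ≤ q → q < x₀ →
      h s = c * q ^ 2 → q ^ 2 ≤ C * g (s ^ (1 / K) * q ^ (1 - 1 / K))) :
    ∃ (E : Set ℂ) (φ : ℂ ≃ₜ ℂ), IsCompact E ∧ IsQuasiconformal K φ ∧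
      ENNReal.ofReal (32 : ℝ)⁻¹ ≤ gaugeHausdorff h E ∧
      gaugeHausdorff h E ≤ ENNReal.ofReal 32 ∧ 0 < gaugeHausdorff g (φ '' E) := by
  obtain ⟨r₀, hr₀1, hr₀⟩ : ∃ r₀, h r₀ ≤ 1 ∧ r₀ ∈ Ioo 0 x₀ :=
    ((hh.tendsto_zero.eventually (ge_mem_nhds one_pos)).and
      (Ioo_mem_nhdsGT hx₀)).exists
  obtain ⟨q₀, hq₀, hhq₀, S, hSq₀, hS, hSmul⟩ := hh.exists_radius h0 hanti hr₀
  have hq₀pos := hq₀.1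
  have hhpos := hh.pos q₀ hq₀pos
  -- As `h q₀ ≤ 1`, this many roots put the total gauge `M * h q₀` between 1 and 2. The measure is
  -- then between 1/18 and 32, where 32 uses `h (4 * r) ≤ 16 * h r`.
  set M := ⌈1 / h q₀⌉₊ with hM
  have hM1 : 1 ≤ M * h q₀ := (div_le_iff₀ hhpos).1 (Nat.le_ceil _)
  have hM2 : M * h q₀ ≤ 2 := by
    have h1 := (Nat.ceil_lt_add_one (by positivity : 0 ≤ 1 / h q₀)).le
    calc M * h q₀ ≤ (1 / h q₀ + 1) * h q₀ := by gcongr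
      _ = 1 + h q₀ := by field_simp
      _ ≤ 2 := by linarith
  obtain ⟨τ, hτ, hcard⟩ := exists_diskTree hq₀pos M
  have hSr : τ.IsRadius S := by
    refine ⟨fun q hq => ?_, ?_, fun q hq => ?_⟩
    · exact (hS q (by rwa [hτ] at hq)).1
    · rw [hτ, hSq₀]
    · exact hSmul q (by rwa [hτ] at hq)
  set c := h q₀ / q₀ ^ 2 with hc
  have hc0 : 0 < c := by positivity
  have hcM : c * (M * q₀ ^ 2) = M * h q₀ := by rw [hc]; field_simp
  obtain ⟨φ, hφ, himage⟩ := hSr.exists_isQuasiconformal hK (fun η hη => by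
    have hev : ∀ᶠ r in 𝓝[>] (0 : ℝ), c / η ^ 2 ≤ h r / r ^ 2 := hinf.eventually_ge_atTop _
    obtain ⟨δ, hδ, hsub⟩ := mem_nhdsGT_iff_exists_Ioo_subset.1 hev
    refine ⟨δ, hδ, fun q hq hqδ => ?_⟩
    obtain ⟨h1, h2, h3⟩ := hS q (by rwa [hτ] at hq)
    have h4 : c / η ^ 2 ≤ h (S q) / S q ^ 2 := hsub ⟨h1, h2.trans_lt hqδ⟩
    rw [h3, div_le_div_iff₀ (by positivity) (by positivity)] at h4
    refine (pow_le_pow_iff_left₀ h1.le (mul_nonneg hη.le hq.1.le) two_ne_zero).1 ?_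
    refine le_of_mul_le_mul_left ?_ hc0
    calc c * S q ^ 2 ≤ c * q ^ 2 * η ^ 2 := h4
      _ = c * (η * q) ^ 2 := by ring)
  have hlt : τ.q₀ < x₀ := by rw [hτ]; exact hq₀.2.trans_lt hr₀.2
  refine ⟨τ.limitSet S, φ, DiskTree.isCompact_limitSet, hφ, ?_, ?_, ?_⟩
  · refine le_trans (ENNReal.ofReal_le_ofReal ?_) (hSr.le_gaugeHausdorff (g := h) (C := c⁻¹)
      (by positivity) hlt (fun r hr => hh.pos r hr.1)
      (hh.monotoneOn.mono fun r hr => hr.1.le) hanti fun q hq => ?_)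
    · rw [hτ, hcard, div_mul_eq_div_div, div_inv_eq_mul]
      rw [div_mul_eq_mul_div, mul_comm _ c, hcM]
      norm_num
      linarith
    · rw [(hS q (by rwa [hτ] at hq)).2.2, inv_mul_cancel_left₀ hc0.ne']
  · refine (hSr.gaugeHausdorff_limitSet_le (g := h) (C := 16 * c) hx₀ h0
      (fun q hq hqx => ?_) (by positivity)).trans (ENNReal.ofReal_le_ofReal ?_)
    · obtain ⟨h1, h2, h3⟩ := hS q (by rwa [hτ] at hq)
      have h4 := mul_sq_le_of_antitoneOn hanti h1 (by linarith : S q ≤ 4 * S q) hqx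
      rw [h3] at h4
      have h5 : 0 < S q ^ 2 := by positivity
      refine le_of_mul_le_mul_right (h4.trans_eq ?_) h5
      ring
    · rw [hτ, hcard, mul_assoc, hcM]
      linarith
  · rw [himage]
    obtain ⟨C, hC, hCq⟩ := hcomp c hc0
    refine lt_of_lt_of_le (ENNReal.ofReal_pos.2 ?_) ((hSr.stretchRadius hK).le_gaugeHausdorff
      hC hlt gpos gmono ganti fun q hq => ?_)
    · have : 0 < M := Nat.ceil_pos.2 (by positivity)
      rw [hτ, hcard]
      positivity
    · obtain ⟨h1, h2, h3⟩ := hS q (by rwa [hτ] at hq)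
      exact hCq (S q) q h1 h2 (hq.2.trans_lt hlt) h3

/-! ### The two families of gauges. -/

section Gauges

variable {K d : ℝ} {ε : ℝ → ℝ}

theorem IsGauge.eps_pos (hh : IsGauge fun t => t ^ d * ε t) {t : ℝ} (ht : 0 < t) : 0 < ε t :=
  pos_of_mul_pos_right (hh.pos t ht) (Real.rpow_nonneg ht.le d)

theorem targetDim_eq (hK : 1 ≤ K) (hd : 0 < d) : 0 < 2 / (2 + (K - 1) * d) ∧
    targetDim K d = K * d * (2 / (2 + (K - 1) * d)) ∧
    targetDim K d - 2 = (d - 2) * (2 / (2 + (K - 1) * d)) := by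
  have h : 0 < 2 + (K - 1) * d := by nlinarith
  refine ⟨by positivity, ?_, ?_⟩
  · rw [targetDim]; ring
  · have h' := h.ne'
    rw [targetDim, ← mul_div_assoc, eq_div_iff h', sub_mul, div_mul_cancel₀ _ h']; ring

theorem rpow_mul_div_sq {t : ℝ} (ht : 0 < t) (e : ℝ) :
    t ^ d * e / t ^ 2 = t ^ (d - 2) * e := by
  rw [Real.rpow_sub ht, Real.rpow_two]
  ring

/-- The relation between the size of a cell and the radii of its disk and of the image disk. -/
theorem rpow_targetDim_mul (hK : 1 ≤ K) (hd : 0 < d) {c s q e : ℝ} (hc : 0 < c) (hs : 0 < s)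
    (hq : 0 < q) (he : 0 < e) (h : s ^ d * e = c * q ^ 2) :
    (s ^ (1 / K) * q ^ (1 - 1 / K)) ^ targetDim K d * e ^ (2 / (2 + (K - 1) * d)) =
      c ^ (2 / (2 + (K - 1) * d)) * q ^ 2 := by
  have hK0 : 0 < K := by linarith
  obtain ⟨hβ, hdim, -⟩ := targetDim_eq hK hd
  have hq2 : q ^ 2 = q ^ (2 : ℝ) := (Real.rpow_two q).symm
  have hden : 2 + (K - 1) * d ≠ 0 := by nlinarith
  set β := 2 / (2 + (K - 1) * d) with hβdef
  -- After this power the exponents of `q` add up to `2 * β + (K - 1) * d * β = 2`; this is what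
  -- fixes `β` and the target dimension.
  have h1 : (s ^ d * e) ^ β = (c * q ^ 2) ^ β := by rw [h]
  rw [Real.mul_rpow (by positivity) he.le, Real.mul_rpow hc.le (by positivity), hq2,
    ← Real.rpow_mul hs.le, ← Real.rpow_mul hq.le] at h1
  rw [Real.mul_rpow (by positivity) (by positivity), ← Real.rpow_mul hs.le, ← Real.rpow_mul hq.le,
    show 1 / K * targetDim K d = d * β by rw [hdim]; field_simp]
  calc s ^ (d * β) * q ^ ((1 - 1 / K) * targetDim K d) * e ^ β
      = s ^ (d * β) * e ^ β * q ^ ((1 - 1 / K) * targetDim K d) := by ring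
    _ = c ^ β * (q ^ (2 * β) * q ^ ((1 - 1 / K) * targetDim K d)) := by rw [h1]; ring
    _ = c ^ β * q ^ 2 := by
      rw [← Real.rpow_add hq, hq2]
      congr 2
      rw [hdim, hβdef]
      field_simp

/-- The image radius `t` satisfies `t ^ K = s * q ^ (K - 1) ≤ s` since `q ≤ 1`, so `ε (t ^ K) ≥ ε
s`. -/
theorem exists_of_decreasingCase (hK : 1 ≤ K) (hd : 0 < d) (hd2 : d < 2) {t₀ : ℝ} (ht₀ : 0 < t₀)
    (hh : IsGauge fun t => t ^ d * ε t) (hε : DecreasingCase ε t₀) :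
    ∃ (E : Set ℂ) (φ : ℂ ≃ₜ ℂ), IsCompact E ∧ IsQuasiconformal K φ ∧
      ENNReal.ofReal (32 : ℝ)⁻¹ ≤ gaugeHausdorff (fun t => t ^ d * ε t) E ∧
      gaugeHausdorff (fun t => t ^ d * ε t) E ≤ ENNReal.ofReal 32 ∧
      0 < gaugeHausdorff (targetGaugeA K d ε) (φ '' E) := by
  obtain ⟨hβ, hdim, hdim2⟩ := targetDim_eq hK hd
  set β := 2 / (2 + (K - 1) * d) with hβdef
  have hK0 : 0 < K := by linarith
  have hpow : ∀ t ∈ Ioo 0 (min t₀ 1), t ^ K ∈ Ioo 0 t₀ ∧ t ^ K ≤ t := by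
    intro t ht
    have h1 : t ^ K ≤ t := by
      simpa using Real.rpow_le_rpow_of_exponent_ge ht.1 (ht.2.le.trans (min_le_right _ _)) hK
    exact ⟨⟨Real.rpow_pos_of_pos ht.1 _, h1.trans_lt (ht.2.trans_le (min_le_left _ _))⟩, h1⟩
  -- The target is the `β`-th power of the source gauge at `t ^ K`, from which it inherits
  -- positivity and monotonicity.
  have hA : ∀ t, 0 < t → targetGaugeA K d ε t = ((t ^ K) ^ d * ε (t ^ K)) ^ β := by
    intro t ht
    have h1 := hh.eps_pos (Real.rpow_pos_of_pos ht K)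
    rw [targetGaugeA, Real.mul_rpow (by positivity) h1.le, ← Real.rpow_mul ht.le,
      ← Real.rpow_mul ht.le, hdim]
  refine exists_compact_quasiconformal hK (x₀ := min t₀ 1) (lt_min ht₀ one_pos) hh
    (by simp [Real.zero_rpow hd.ne']) ?_ ?_ ?_ ?_ ?_ ?_
  · intro r hr s hs hrs
    simp only [rpow_mul_div_sq hr.1, rpow_mul_div_sq hs.1]
    have h1 := hh.eps_pos hs.1
    have h2 := hr.1
    refine mul_le_mul (Real.rpow_le_rpow_of_nonpos hr.1 hrs (by linarith)) ?_ h1.le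
      (by positivity)
    exact hε.strictAntiOn.antitoneOn ⟨hr.1, hr.2.trans_le (min_le_left _ _)⟩
      ⟨hs.1, hs.2.trans_le (min_le_left _ _)⟩ hrs
  · refine tendsto_atTop_mono' _ ?_ hε.tendsto_atTop
    filter_upwards [Ioo_mem_nhdsGT one_pos] with r hr
    rw [rpow_mul_div_sq hr.1]
    exact le_mul_of_one_le_left (hh.eps_pos hr.1).le
      (Real.one_le_rpow_of_pos_of_le_one_of_nonpos hr.1 hr.2.le (by linarith))
  · intro r hr
    rw [hA r hr.1]
    exact Real.rpow_pos_of_pos (hh.pos _ (hpow r hr).1.1) _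
  · intro r hr s hs hrs
    rw [hA r hr.1, hA s hs.1]
    have h1 := (hh.pos _ (hpow r hr).1.1).le
    refine Real.rpow_le_rpow h1 ?_ hβ.le
    exact hh.monotoneOn (hpow r hr).1.1.le (hpow s hs).1.1.le
      (Real.rpow_le_rpow hr.1.le hrs hK0.le)
  · intro r hr s hs hrs
    simp only [targetGaugeA, rpow_mul_div_sq hr.1, rpow_mul_div_sq hs.1, hdim2]
    have h1 := hh.eps_pos (hpow s hs).1.1
    have h2 := hr.1
    have h3 : (d - 2) * β ≤ 0 := mul_nonpos_of_nonpos_of_nonneg (by linarith) hβ.le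
    refine mul_le_mul (Real.rpow_le_rpow_of_nonpos hr.1 hrs h3)
      (Real.rpow_le_rpow h1.le ?_ hβ.le) (by positivity) (by positivity)
    exact hε.strictAntiOn.antitoneOn (hpow r hr).1 (hpow s hs).1
      (Real.rpow_le_rpow hr.1.le hrs hK0.le)
  · intro c hc
    refine ⟨(c ^ β)⁻¹, by positivity, fun s q hs hsq hq h => ?_⟩
    have hq0 := hs.trans_le hsq
    have hes := hh.eps_pos hs
    have h1 := rpow_targetDim_mul hK hd hc hs hq0 hes h
    have hcβ : 0 < c ^ β := by positivity
    rw [← mul_le_mul_iff_right₀ hcβ, ← mul_assoc, mul_inv_cancel₀ hcβ.ne', one_mul, ← h1,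
      targetGaugeA]
    set t := s ^ (1 / K) * q ^ (1 - 1 / K) with ht
    have hq1 : q ≤ 1 := hq.le.trans (min_le_right _ _)
    have htK : t ^ K ≤ s := by
      rw [ht, Real.mul_rpow (by positivity) (by positivity), ← Real.rpow_mul hs.le,
        ← Real.rpow_mul hq0.le, one_div_mul_cancel hK0.ne', Real.rpow_one]
      refine mul_le_of_le_one_right hs.le (Real.rpow_le_one hq0.le hq1 ?_)
      rw [sub_mul, one_div_mul_cancel hK0.ne']
      linarith
    have hs' : s < t₀ := (hsq.trans_lt hq).trans_le (min_le_left _ _)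
    have ht0 : 0 < t ^ K := by positivity
    gcongr
    exact hε.strictAntiOn.antitoneOn ⟨ht0, htK.trans_lt hs'⟩ ⟨hs, hs'⟩ htK

/-- The image radius is a weighted geometric mean of `s` and `q`, hence at least `s`, so `ε t ≥ ε
s`. Monotonicity of `ε ^ (1 / (2 - d)) / t` supplies that of both gauges divided by the square. -/
theorem exists_of_increasingCase (hK : 1 ≤ K) (hd : 0 < d) (hd2 : d < 2) {t₀ : ℝ} (ht₀ : 0 < t₀)
    (hh : IsGauge fun t => t ^ d * ε t) (hε : IncreasingCase K d ε t₀) :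
    ∃ (E : Set ℂ) (φ : ℂ ≃ₜ ℂ), IsCompact E ∧ IsQuasiconformal K φ ∧
      ENNReal.ofReal (32 : ℝ)⁻¹ ≤ gaugeHausdorff (fun t => t ^ d * ε t) E ∧
      gaugeHausdorff (fun t => t ^ d * ε t) E ≤ ENNReal.ofReal 32 ∧
      0 < gaugeHausdorff (targetGaugeB K d ε) (φ '' E) := by
  obtain ⟨hβ, hdim, hdim2⟩ := targetDim_eq hK hd
  set β := 2 / (2 + (K - 1) * d) with hβdef
  have hK0 : 0 < K := by linarith
  have hdim0 : 0 ≤ targetDim K d := by rw [hdim]; positivity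
  have hquot : ∀ r, 0 < r → r ^ (d - 2) * ε r = (ε r ^ (1 / (2 - d)) / r) ^ (2 - d) := by
    intro r hr
    have h1 := hh.eps_pos hr
    have h2 : 2 - d ≠ 0 := by linarith
    rw [Real.div_rpow (by positivity) hr.le, ← Real.rpow_mul h1.le, one_div_mul_cancel h2,
      Real.rpow_one, show d - 2 = -(2 - d) by ring, Real.rpow_neg hr.le]
    ring
  have hanti : AntitoneOn (fun r => r ^ (d - 2) * ε r) (Ioo 0 t₀) := by
    intro r hr s hs hrs
    have h1 := hh.eps_pos hs.1
    have h2 := hs.1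
    simp only [hquot r hr.1, hquot s hs.1]
    exact Real.rpow_le_rpow (by positivity) (hε.antitoneOn hr hs hrs) (by linarith)
  refine exists_compact_quasiconformal hK (x₀ := t₀) ht₀ hh
    (by simp [Real.zero_rpow hd.ne']) ?_ ?_ ?_ ?_ ?_ ?_
  · intro r hr s hs hrs
    simp only [rpow_mul_div_sq hr.1, rpow_mul_div_sq hs.1]
    exact hanti hr hs hrs
  · have h1 : Tendsto (fun t => t ^ (2 - d) / ε t) (𝓝[>] 0) (𝓝[>] 0) := by
      refine tendsto_nhdsWithin_iff.2 ⟨hε.subpolynomial (2 - d) (by linarith), ?_⟩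
      filter_upwards [self_mem_nhdsWithin] with t ht
      have h1 := hh.eps_pos ht
      have h2 : 0 < t := ht
      exact mem_Ioi.2 (by positivity)
    refine h1.inv_tendsto_nhdsGT_zero.congr' ?_
    filter_upwards [self_mem_nhdsWithin] with t ht
    have h2 : 0 < t := ht
    rw [rpow_mul_div_sq h2, Pi.inv_apply, inv_div, show d - 2 = -(2 - d) by ring,
      Real.rpow_neg h2.le]
    ring
  · intro r hr
    have h1 := hh.eps_pos hr.1
    have h2 := hr.1
    rw [targetGaugeB]
    positivity
  · intro r hr s hs hrs
    have h1 := hh.eps_pos hr.1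
    have h2 := hr.1
    have h3 := hs.1
    rw [targetGaugeB, targetGaugeB]
    refine mul_le_mul (Real.rpow_le_rpow h2.le hrs hdim0)
      (Real.rpow_le_rpow h1.le (hε.strictMonoOn.monotoneOn hr hs hrs) hβ.le) (by positivity)
      (by positivity)
  · intro r hr s hs hrs
    have e : ∀ r, 0 < r → targetGaugeB K d ε r / r ^ 2 = (r ^ (d - 2) * ε r) ^ β := by
      intro r hr
      have h1 := hh.eps_pos hr
      rw [targetGaugeB, rpow_mul_div_sq hr, hdim2, Real.mul_rpow (by positivity) h1.le,
        ← Real.rpow_mul hr.le]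
    have h1 := hh.eps_pos hs.1
    have h2 := hs.1
    simp only [e r hr.1, e s hs.1]
    exact Real.rpow_le_rpow (by positivity) (hanti hr hs hrs) hβ.le
  · intro c hc
    refine ⟨(c ^ β)⁻¹, by positivity, fun s q hs hsq hq h => ?_⟩
    have hq0 := hs.trans_le hsq
    have hes := hh.eps_pos hs
    have h1 := rpow_targetDim_mul hK hd hc hs hq0 hes h
    have hcβ : 0 < c ^ β := by positivity
    rw [← mul_le_mul_iff_right₀ hcβ, ← mul_assoc, mul_inv_cancel₀ hcβ.ne', one_mul, ← h1,
      targetGaugeB]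
    set t := s ^ (1 / K) * q ^ (1 - 1 / K) with ht
    have hKle : 0 ≤ 1 - 1 / K := sub_nonneg.2 ((div_le_one hK0).2 hK)
    have hst : s ≤ t := by
      calc s = s ^ (1 / K) * s ^ (1 - 1 / K) := by
            rw [← Real.rpow_add hs, add_sub_cancel, Real.rpow_one]
        _ ≤ t := by rw [ht]; gcongr
    have htq : t ≤ q := by
      calc t ≤ q ^ (1 / K) * q ^ (1 - 1 / K) := by rw [ht]; gcongr
        _ = q := by rw [← Real.rpow_add hq0, add_sub_cancel, Real.rpow_one]
    have ht0 : 0 < t := hs.trans_le hst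
    gcongr
    exact hε.strictMonoOn.monotoneOn ⟨hs, (hsq.trans_lt hq)⟩ ⟨ht0, htq.trans_lt hq⟩ hst

end Gauges

theorem theorem4p1 :
    ∃ C : ℝ, 1 ≤ C ∧
      ∀ (K d t₀ : ℝ) (ε : ℝ → ℝ), 1 ≤ K → 0 < d → d < 2 → 0 < t₀ →
        IsGauge (fun t => t ^ d * ε t) →
        (DecreasingCase ε t₀ →
          ∃ (E : Set ℂ) (φ : ℂ ≃ₜ ℂ), IsCompact E ∧ IsQuasiconformal K φ ∧
            ENNReal.ofReal C⁻¹ ≤ gaugeHausdorff (fun t => t ^ d * ε t) E ∧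
            gaugeHausdorff (fun t => t ^ d * ε t) E ≤ ENNReal.ofReal C ∧
            0 < gaugeHausdorff (targetGaugeA K d ε) (φ '' E)) ∧
        (IncreasingCase K d ε t₀ →
          ∃ (E : Set ℂ) (φ : ℂ ≃ₜ ℂ), IsCompact E ∧ IsQuasiconformal K φ ∧
            ENNReal.ofReal C⁻¹ ≤ gaugeHausdorff (fun t => t ^ d * ε t) E ∧
            gaugeHausdorff (fun t => t ^ d * ε t) E ≤ ENNReal.ofReal C ∧
            0 < gaugeHausdorff (targetGaugeB K d ε) (φ '' E)) :=
  ⟨32, by norm_num, fun _ _ _ _ hK hd hd2 ht₀ hh =>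
    ⟨exists_of_decreasingCase hK hd hd2 ht₀ hh, exists_of_increasingCase hK hd hd2 ht₀ hh⟩⟩
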